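/- Let $g>0$ and let $\mathcal B=\{b=(b_1,b_2)\in\mathbb R^2: b_1>b_2>b_1^{-1/2}\}$ (with $b_1>0$); for $b\in\mathcal B$ put $b_3=1/(b_1b_2)$, so $b_1>b_2>b_3>0$. Let $$\mathcal V(b)=-2\pi g\int_0^\infty[(s+b_1^2)(s+b_2^2)(s+b_3^2)]^{-1/2}\,ds,\qquad \mathbb K(b)=\frac{1}{b_2^2b_3^2+b_1^2b_3^2+b_1^2b_2^2}\begin{pmatrix}b_1^2(b_2^2+b_3^2)&-b_3\\-b_3&b_2^2(b_1^2+b_3^2)\end{pmatrix},$$ $$J_1(b)=\mathrm{diag}\Big(\tfrac{b_2^2+b_3^2}{(b_2^2-b_3^2)^2},\tfrac{b_1^2+b_3^2}{(b_1^2-b_3^2)^2},\tfrac{b_1^2+b_2^2}{(b_1^2-b_2^2)^2}\Big),\quad J_2(b)=\mathrm{diag}\Big(\tfrac{2b_2b_3}{(b_2^2-b_3^2)^2},\tfrac{2b_1b_3}{(b_1^2-b_3^2)^2},\tfrac{2b_1b_2}{(b_1^2-b_2^2)^2}\Big),\quad \mathbb J=\begin{pmatrix}J_1&J_2\\J_2&J_1\end{pmatrix}.$$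 Reduced systems. For $\eta=(\eta_l,\eta_r)\in(\mathbb R^3)^2$ with $\eta_l\ne0\ne\eta_r$ let $P_\eta=\mathcal B\times\mathbb R^2\times(S^2_{\|\eta_l\|}\times S^2_{\|\eta_r\|})$, whose points are written $(b,c,m)$, $m=(m_l,m_r)$, with Hamiltonian $H_\eta=\frac12c\cdot\mathbb K(b)c+\frac12m\cdot\mathbb J(b)m+\mathcal V(b)$ and symplectic form $\sigma_\eta((v,w,m\times\omega),(v',w',m\times\omega'))=v\cdot w'-v'\cdot w-m\cdot(\omega\times\omega')$, products on $(\mathbb R^3)^2$ being componentwise. If exactly one component of $\eta$ is zero and $\zeta$ denotes the other one, the (six-dimensional) reduced space is $P_\eta=\mathcal B\times\mathbb R^2\times S^2_{\|\zeta\|}$, with points $(b,c,m)$, $m\in\mathbb R^3$, with the same formula for $\sigma_\eta$ and with $H_\eta=\frac12c\cdot\mathbb K(b)c+\frac12m\cdot J_1(b)m+\mathcal V(b)$. An equilibrium is a zero of the Hamiltonian vector field of $H_\eta$. Two points are $\mathbb Z_4\times\mathbb Z_2$-equivalent if one is obtained from the other by a map $(b,c,m)\mapsto(b,c,\pm R_im)$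 with $R_0=1$, $R_1=\mathrm{diag}(1,-1,-1)$, $R_2=\mathrm{diag}(-1,1,-1)$, $R_3=\mathrm{diag}(-1,-1,1)$, where $R_i(m_l,m_r)=(R_im_l,R_im_r)$. Momenta. Let $$C_n(x,y,z)=2\pi g\int_0^\infty[(s+x^2)(s+y^2)(s+z^2)]^{-3/2}s^n\,ds,$$ $$G^S_\pm(x,y,z)=\tfrac{(x\mp z)^4}{xz}\big[\,[xy^2z\pm(x^2y^2-x^2z^2+y^2z^2)]\,C_1(x,y,z)+(xz\pm y^2)\,C_2(x,y,z)\big],$$ $$G(x,y,z)=x^2(y^2-z^2)C_1(x,y,z)+(y^2-4z^2)[z^2C_1(x,y,z)+C_2(x,y,z)],$$ $$D(x,y,z)=x^2(y^2-z^2)+z^2(4z^2-y^2),$$ $$G^R_\pm(x,y,z)=(y\mp z)^4\,(x^2-(y\pm2z)^2)\,\frac{x^2-z^2}{x^2-y^2}\,\frac{G(x,y,z)}{D(x,y,z)},$$ $$N^\tau_\pm=\tfrac12\big[\sqrt{G^\tau_+}\pm\sqrt{G^\tau_-}\big]\quad(\tau=R,S),$$ let $$\mathcal B_{S_2}=\{b\in\mathcal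 B:G^S_-(b_1,b_2,b_3)\ge0\},\qquad \mathcal B_{S_3}=\{b\in\mathcal B:G^S_+(b_1,b_3,b_2)\ge0\},\qquad \mathcal B_{I}=\{b\in\mathcal B:b_1\le2b_2-b_3\},$$ $$\mathcal B_{II}=\{b\in\mathcal B:b_1\ge2b_2+b_3,\ D(b_1,b_3,b_2)<0\},\qquad \mathcal B_{III}=\{b\in\mathcal B:b_1\ge b_2+2b_3,\ G(b_1,b_2,b_3)>0\},$$ and, with $e_1,e_2,e_3$ the standard basis of $\mathbb R^3$, $$\mu_{S_2}^\pm(b)=N^S_\pm(b_1,b_2,b_3)e_2,\qquad \mu_{S_3}^\pm(b)=N^S_\pm(b_1,b_3,b_2)e_3,\qquad \mu_I^\pm(b)=N^R_\pm(b_1,b_3,b_2)e_1+N^R_\pm(b_3,b_1,b_2)e_3,$$ $$\mu_{II}^\pm(b)=N^R_\pm(b_1,b_3,b_2)e_1+N^R_\mp(b_3,b_1,b_2)e_3,\qquad \mu_{III}^\pm(b)=N^R_\pm(b_1,b_2,b_3)e_1+N^R_\mp(b_2,b_1,b_3)e_2.$$ Then the following hold. (0) Each $\mu_\alpha^\pm$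 is a real-valued map on $\mathcal B_\alpha$: there, in the formulas used, no denominator vanishes and no quantity under a square root is negative. (i) If $\eta_l\ne0\ne\eta_r$, a point $(b,c,m)\in P_\eta$ is an equilibrium of $(P_\eta,H_\eta,\sigma_\eta)$ if and only if for some $\alpha\in\{S_2,S_3,I,II,III\}$ one has $b\in\mathcal B_\alpha$ and the point is $\mathbb Z_4\times\mathbb Z_2$-equivalent to $(b,0,(\mu_\alpha^+(b),\mu_\alpha^-(b)))$ or to $(b,0,(\mu_\alpha^-(b),\mu_\alpha^+(b)))$. (ii) If exactly one component of $\eta$ is zero, a point $(b,c,m)\in P_\eta$ is an equilibrium of the six-dimensional reduced system if and only if it is $\mathbb Z_4\times\mathbb Z_2$-equivalent to $(b,0,\mu_\alpha^+(b))$, where either $\alpha=S_2$, $b\in\mathcal B_{S_2}$ and $G^S_+(b_1,b_2,b_3)=G^S_-(b_1,b_2,b_3)$, or $\alpha=I$, $b\in\mathcal B_I$ and $b_1^2b_2^2+b_1^2b_3^2+b_2^2b_3^2-3b_2^4=0$. Moreover, for $b\in\mathcal B_\alpha$ one of $\mu_\alpha^+(b)$, $\mu_\alpha^-(b)$ vanishes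 exactly in these two cases, and then $\mu_\alpha^+(b)\ne0=\mu_\alpha^-(b)$. -/

import Mathlib

open MeasureTheory Matrix

noncomputable section

namespace RiemannEllipsoid

/-- The plane `ℝ²` (for the two independent semiaxes and their conjugate momenta). -/
abbrev V2 := Fin 2 → ℝ

/-- The space `ℝ³`; coordinates `0, 1, 2` are those along `e₁, e₂, e₃`. -/
abbrev V3 := Fin 3 → ℝ

/-- Euclidean norm on `ℝ³` (the type `Fin 3 → ℝ` itself carries the sup norm). -/
def euclNorm (v : V3) : ℝ := √(v ⬝ᵥ v)

/-- The standard basis vectors `e₁, e₂, e₃`. -/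
def e₁ : V3 := ![1, 0, 0]
def e₂ : V3 := ![0, 1, 0]
def e₃ : V3 := ![0, 0, 1]

/-! ### Semiaxes -/

/-- The three semiaxes; the third one is determined by `b₁ b₂ b₃ = 1`. -/
def b₁ (b : V2) : ℝ := b 0
def b₂ (b : V2) : ℝ := b 1
def b₃ (b : V2) : ℝ := 1 / (b 0 * b 1)

/-- The configuration space `{(b₁, b₂) : b₁ > b₂ > b₁^(-1/2)}`, where `b₁ > 0`
(so that the power makes sense); it describes `b₁ > b₂ > b₃ > 0`. -/
def configSpace : Set V2 :=
  {b | 0 < b₁ b ∧ b₂ b < b₁ b ∧ (b₁ b) ^ (-(1 / 2) : ℝ) < b₂ b}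

/-! ### The Hamiltonian -/

/-- The self-gravitational potential of the ellipsoid with semiaxes proportional to `x, y, z`. -/
def potential (g x y z : ℝ) : ℝ :=
  -2 * Real.pi * g *
    ∫ s in Set.Ioi (0 : ℝ), ((s + x ^ 2) * (s + y ^ 2) * (s + z ^ 2)) ^ (-(1 / 2) : ℝ)

/-- The matrix of the kinetic energy of the semiaxes. -/
def K (b : V2) : Matrix (Fin 2) (Fin 2) ℝ :=
  (1 / (b₂ b ^ 2 * b₃ b ^ 2 + b₁ b ^ 2 * b₃ b ^ 2 + b₁ b ^ 2 * b₂ b ^ 2)) •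
    !![b₁ b ^ 2 * (b₂ b ^ 2 + b₃ b ^ 2), -b₃ b;
       -b₃ b, b₂ b ^ 2 * (b₁ b ^ 2 + b₃ b ^ 2)]

/-- The diagonal blocks of the inverse inertia matrix. -/
def J₁ (b : V2) : Matrix (Fin 3) (Fin 3) ℝ :=
  diagonal ![(b₂ b ^ 2 + b₃ b ^ 2) / (b₂ b ^ 2 - b₃ b ^ 2) ^ 2,
             (b₁ b ^ 2 + b₃ b ^ 2) / (b₁ b ^ 2 - b₃ b ^ 2) ^ 2,
             (b₁ b ^ 2 + b₂ b ^ 2) / (b₁ b ^ 2 - b₂ b ^ 2) ^ 2]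

/-- The off-diagonal blocks of the inverse inertia matrix. -/
def J₂ (b : V2) : Matrix (Fin 3) (Fin 3) ℝ :=
  diagonal ![2 * b₂ b * b₃ b / (b₂ b ^ 2 - b₃ b ^ 2) ^ 2,
             2 * b₁ b * b₃ b / (b₁ b ^ 2 - b₃ b ^ 2) ^ 2,
             2 * b₁ b * b₂ b / (b₁ b ^ 2 - b₂ b ^ 2) ^ 2]

/-! ### The generic reduced system: both momenta nonzero -/

/-- The ambient space of the generic reduced spaces: points `(b, c, (m_l, m_r))`. -/
abbrev Phase := V2 × V2 × (V3 × V3)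

/-- The reduced space `𝓑 × ℝ² × (S²_{‖η_l‖} × S²_{‖η_r‖})`. -/
def reducedSpace (η : V3 × V3) : Set Phase :=
  {p | p.1 ∈ configSpace ∧ euclNorm p.2.2.1 = euclNorm η.1 ∧ euclNorm p.2.2.2 = euclNorm η.2}

/-- The reduced Hamiltonian `½ c·K(b)c + ½ m·J(b)m + V(b)`. -/
def hamiltonian (g : ℝ) (p : Phase) : ℝ :=
  let b := p.1
  let c := p.2.1
  let ml := p.2.2.1
  let mr := p.2.2.2
  1 / 2 * (c ⬝ᵥ (K b *ᵥ c))
    + 1 / 2 * (ml ⬝ᵥ (J₁ b *ᵥ ml + J₂ b *ᵥ mr) + mr ⬝ᵥ (J₂ b *ᵥ ml + J₁ b *ᵥ mr))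
    + potential g (b₁ b) (b₂ b) (b₃ b)

/-- The tangent vector `(v, w, m × ω)` to the reduced space at `p`
represented by the triple `(v, w, ω)`. -/
def tangent (p : Phase) (X : Phase) : Phase :=
  (X.1, X.2.1, (crossProduct p.2.2.1 X.2.2.1, crossProduct p.2.2.2 X.2.2.2))

/-- The reduced symplectic form `v·w' - v'·w - m·(ω × ω')`, evaluated on the tangent vectors
`(v, w, m × ω)` and `(v', w', m × ω')`. -/
def symplecticForm (p : Phase) (X Y : Phase) : ℝ :=
  X.1 ⬝ᵥ Y.2.1 - Y.1 ⬝ᵥ X.2.1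
    - (p.2.2.1 ⬝ᵥ crossProduct X.2.2.1 Y.2.2.1 + p.2.2.2 ⬝ᵥ crossProduct X.2.2.2 Y.2.2.2)

/-- `X` represents the value at `p` of the Hamiltonian vector field: `σ(X, ·) = dH` on the
tangent space of the reduced space. -/
def IsHamiltonianVector (g : ℝ) (p : Phase) (X : Phase) : Prop :=
  ∀ Y : Phase, symplecticForm p X Y = fderiv ℝ (hamiltonian g) p (tangent p Y)

/-- `p` is an equilibrium of the reduced system: the Hamiltonian vector field vanishes at `p`. -/
def IsEquilibrium (g : ℝ) (p : Phase) : Prop :=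
  ∃ X : Phase, IsHamiltonianVector g p X ∧ tangent p X = 0

/-! ### The irrotational reduced system: exactly one momentum nonzero -/

/-- The ambient space of the six-dimensional reduced spaces: points `(b, c, m)`. -/
abbrev IrrPhase := V2 × V2 × V3

open Classical in
/-- The nonzero component of `η = (η_l, 0)` or `η = (0, η_r)`. -/
def nonzeroComponent (η : V3 × V3) : V3 := if η.1 = 0 then η.2 else η.1

/-- The six-dimensional reduced space `𝓑 × ℝ² × S²`. -/
def irrReducedSpace (η : V3 × V3) : Set IrrPhase :=
  {p | p.1 ∈ configSpace ∧ euclNorm p.2.2 = euclNorm (nonzeroComponent η)}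

/-- The reduced Hamiltonian `½ c·K(b)c + ½ m·J₁(b)m + V(b)`. -/
def irrHamiltonian (g : ℝ) (p : IrrPhase) : ℝ :=
  let b := p.1
  let c := p.2.1
  let m := p.2.2
  1 / 2 * (c ⬝ᵥ (K b *ᵥ c)) + 1 / 2 * (m ⬝ᵥ (J₁ b *ᵥ m))
    + potential g (b₁ b) (b₂ b) (b₃ b)

/-- The tangent vector `(v, w, m × ω)` represented by `(v, w, ω)`. -/
def irrTangent (p : IrrPhase) (X : IrrPhase) : IrrPhase :=
  (X.1, X.2.1, crossProduct p.2.2 X.2.2)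

/-- The reduced symplectic form on `(v, w, m × ω)` and `(v', w', m × ω')`. -/
def irrSymplecticForm (p : IrrPhase) (X Y : IrrPhase) : ℝ :=
  X.1 ⬝ᵥ Y.2.1 - Y.1 ⬝ᵥ X.2.1 - p.2.2 ⬝ᵥ crossProduct X.2.2 Y.2.2

/-- `X` represents the value at `p` of the Hamiltonian vector field. -/
def IsIrrHamiltonianVector (g : ℝ) (p : IrrPhase) (X : IrrPhase) : Prop :=
  ∀ Y : IrrPhase, irrSymplecticForm p X Y = fderiv ℝ (irrHamiltonian g) p (irrTangent p Y)

/-- `p` is an equilibrium of the six-dimensional reduced system. -/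
def IsIrrEquilibrium (g : ℝ) (p : IrrPhase) : Prop :=
  ∃ X : IrrPhase, IsIrrHamiltonianVector g p X ∧ irrTangent p X = 0

/-! ### The discrete symmetries -/

/-- The four diagonal matrices of determinant one with entries `±1`. -/
def R : Fin 4 → Matrix (Fin 3) (Fin 3) ℝ :=
  ![1, diagonal ![1, -1, -1], diagonal ![-1, 1, -1], diagonal ![-1, -1, 1]]

/-- `p` is obtained from `q` by the action `(b, c, m) ↦ (b, c, ± Rᵢ m)`. -/
def Equivalent (p q : Phase) : Prop :=
  ∃ i : Fin 4, ∃ ε : ℝ, (ε = 1 ∨ ε = -1) ∧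
    p = (q.1, q.2.1, (ε • (R i *ᵥ q.2.2.1), ε • (R i *ᵥ q.2.2.2)))

/-- The same equivalence on the six-dimensional reduced spaces. -/
def IrrEquivalent (p q : IrrPhase) : Prop :=
  ∃ i : Fin 4, ∃ ε : ℝ, (ε = 1 ∨ ε = -1) ∧ p = (q.1, q.2.1, ε • (R i *ᵥ q.2.2))

/-! ### Existence regions and momenta

A subscript `±` is a real argument `ε`, to be taken equal to `1` or `-1`. -/

/-- The integrals `C_n`. -/
def C (g : ℝ) (n : ℕ) (x y z : ℝ) : ℝ :=
  2 * Real.pi * g *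
    ∫ s in Set.Ioi (0 : ℝ),
      ((s + x ^ 2) * (s + y ^ 2) * (s + z ^ 2)) ^ (-(3 / 2) : ℝ) * s ^ n

/-- The functions `G^S_±`. -/
def GS (g ε x y z : ℝ) : ℝ :=
  (x - ε * z) ^ 4 / (x * z) *
    ((x * y ^ 2 * z + ε * (x ^ 2 * y ^ 2 - x ^ 2 * z ^ 2 + y ^ 2 * z ^ 2)) * C g 1 x y z
      + (x * z + ε * y ^ 2) * C g 2 x y z)

/-- The function `G`. -/
def G (g x y z : ℝ) : ℝ :=
  x ^ 2 * (y ^ 2 - z ^ 2) * C g 1 x y z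
    + (y ^ 2 - 4 * z ^ 2) * (z ^ 2 * C g 1 x y z + C g 2 x y z)

/-- The function `D`. -/
def D (x y z : ℝ) : ℝ :=
  x ^ 2 * (y ^ 2 - z ^ 2) + z ^ 2 * (4 * z ^ 2 - y ^ 2)

/-- The functions `G^R_±`. -/
def GR (g ε x y z : ℝ) : ℝ :=
  (y - ε * z) ^ 4 * (x ^ 2 - (y + ε * (2 * z)) ^ 2) * ((x ^ 2 - z ^ 2) / (x ^ 2 - y ^ 2))
    * (G g x y z / D x y z)

/-- `N^S_±`. -/
def NS (g ε x y z : ℝ) : ℝ := 1 / 2 * (√(GS g 1 x y z) + ε * √(GS g (-1) x y z))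

/-- `N^R_±`. -/
def NR (g ε x y z : ℝ) : ℝ := 1 / 2 * (√(GR g 1 x y z) + ε * √(GR g (-1) x y z))

/-- The five types of Riemann ellipsoids. -/
inductive EllipsoidType
  | S2 | S3 | I | II | III

/-- The existence regions. -/
def region (g : ℝ) : EllipsoidType → Set V2
  | .S2 => {b | b ∈ configSpace ∧ 0 ≤ GS g (-1) (b₁ b) (b₂ b) (b₃ b)}
  | .S3 => {b | b ∈ configSpace ∧ 0 ≤ GS g 1 (b₁ b) (b₃ b) (b₂ b)}
  | .I => {b | b ∈ configSpace ∧ b₁ b ≤ 2 * b₂ b - b₃ b}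
  | .II => {b | b ∈ configSpace ∧ 2 * b₂ b + b₃ b ≤ b₁ b ∧ D (b₁ b) (b₃ b) (b₂ b) < 0}
  | .III => {b | b ∈ configSpace ∧ b₂ b + 2 * b₃ b ≤ b₁ b ∧ 0 < G g (b₁ b) (b₂ b) (b₃ b)}

/-- The momenta `μ_α^±`; here `μ g α 1` is `μ_α^+` and `μ g α (-1)` is `μ_α^-`. -/
def μ (g : ℝ) (α : EllipsoidType) (ε : ℝ) (b : V2) : V3 :=
  match α with
  | .S2 => NS g ε (b₁ b) (b₂ b) (b₃ b) • e₂
  | .S3 => NS g ε (b₁ b) (b₃ b) (b₂ b) • e₃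
  | .I => NR g ε (b₁ b) (b₃ b) (b₂ b) • e₁ + NR g ε (b₃ b) (b₁ b) (b₂ b) • e₃
  | .II => NR g ε (b₁ b) (b₃ b) (b₂ b) • e₁ + NR g (-ε) (b₃ b) (b₁ b) (b₂ b) • e₃
  | .III => NR g ε (b₁ b) (b₂ b) (b₃ b) • e₁ + NR g (-ε) (b₂ b) (b₁ b) (b₃ b) • e₂

/-- `G^S_±(x, y, z)` are defined and nonnegative, so that `N^S_±(x, y, z)` are real. -/
def NSIsReal (g x y z : ℝ) : Prop :=
  x * z ≠ 0 ∧ 0 ≤ GS g 1 x y z ∧ 0 ≤ GS g (-1) x y z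

/-- `G^R_±(x, y, z)` are defined and nonnegative, so that `N^R_±(x, y, z)` are real. -/
def NRIsReal (g x y z : ℝ) : Prop :=
  x ^ 2 - y ^ 2 ≠ 0 ∧ D x y z ≠ 0 ∧ 0 ≤ GR g 1 x y z ∧ 0 ≤ GR g (-1) x y z

/-- The formulas for the momenta of type `α` make sense at `b`: no denominator vanishes and no
radicand is negative. -/
def MomentaAreReal (g : ℝ) (α : EllipsoidType) (b : V2) : Prop :=
  match α with
  | .S2 => NSIsReal g (b₁ b) (b₂ b) (b₃ b)
  | .S3 => NSIsReal g (b₁ b) (b₃ b) (b₂ b)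
  | .I | .II => NRIsReal g (b₁ b) (b₃ b) (b₂ b) ∧ NRIsReal g (b₃ b) (b₁ b) (b₂ b)
  | .III => NRIsReal g (b₁ b) (b₂ b) (b₃ b) ∧ NRIsReal g (b₂ b) (b₁ b) (b₃ b)

/-- The two curves of irrotational ellipsoids, one of type `S2` and one of type `I`. -/
def OnIrrotationalCurve (g : ℝ) (α : EllipsoidType) (b : V2) : Prop :=
  match α with
  | .S2 => GS g 1 (b₁ b) (b₂ b) (b₃ b) = GS g (-1) (b₁ b) (b₂ b) (b₃ b)
  | .I => b₁ b ^ 2 * b₂ b ^ 2 + b₁ b ^ 2 * b₃ b ^ 2 + b₂ b ^ 2 * b₃ b ^ 2 - 3 * b₂ b ^ 4 = 0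
  | .S3 | .II | .III => False

end RiemannEllipsoid

end

open RiemannEllipsoid

/-!
The proposition follows from the equations of the critical points of the Hamiltonian on the reduced
space, which become polynomial in suitable variables.

A point is an equilibrium if and only if the derivative of the Hamiltonian vanishes on the tangent
vectors `(v, w, m × ω)`. Since the kinetic energy of the semiaxes is positive definite, this forces
`c = 0`; the directions `m × ω` say that each momentum is parallel to the corresponding velocity;
and the directions `v` say that centrifugal and gravitational forces balance. The potential is
differentiated under the integral sign (`hasFDerivAt_potential`), and the differences of the forces
`bᵢ ∂V/∂bᵢ` are combinations of `C₁` and `C₂` (`axisIntegral_sub`). The matrices `J₁ ± J₂` are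
diagonal with entries `1 / (bⱼ ∓ bₖ)²`, so that in terms of `u = (J₁ + J₂)(m_l + m_r)` and
`v = (J₁ - J₂)(m_l - m_r)` all equations are polynomial (`isEquilibrium_iff_isSteady`).

Consider two axes of lengths `x`, `y`, the third one having length `z`. If both carry momentum, the
parallelism relations determine the ratios of the squared velocities: along the first axis they are
`t (x² - (y ± 2z)²)` (`PairRelation.ratio`). Comparing these ratios for two different planes shows
that not all three axes carry momentum (`PairRelation.false_of_three`), which is Riemann's theorem.
If exactly two axes carry momentum, the balance of forces is a linear system for the two factors
`t`, with determinant a multiple of `D`, which gives the functions `G^R_±`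
(`exists_planarScale`); the requirement that the squared velocities be nonnegative yields the types
I, II and III, and excludes the plane of the two shorter axes (`exists_isPlanar` and the
identification of the regions). If only one axis carries momentum, the balance of forces gives the
squares `G^S_±` (`balance_single_iff`), with the sign of one of the forces excluding the longest
axis. In all cases the squares leave a choice of signs, which is exactly the action of the matrices
`± Rᵢ`, the diagonal matrices with entries `±1` (`exists_symmetry_iff`), and the exchange of the
two momenta.

An equilibrium of a six-dimensional system is the same as a solution of these equations with one
momentum equal to zero (`isIrrEquilibrium_iff`). The classification does not use that the momenta
are nonzero, so it only remains to determine where `μ⁺` or `μ⁻` vanishes (`momenta_eq_zero`).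
-/

namespace RiemannEllipsoid

/-! ### Gravitational integrals -/

/-- The product `(s + x²)(s + y²)(s + z²)` occurring in all gravitational integrals. -/
def cubic (x y z s : ℝ) : ℝ := (s + x ^ 2) * (s + y ^ 2) * (s + z ^ 2)

lemma cubic_pos {x y z s : ℝ} (hx : 0 < x) (hy : 0 < y) (hz : 0 < z) (hs : 0 < s) :
    0 < cubic x y z s := by unfold cubic; positivity

/-- Comparison of a negative power of the cubic with a power of a single linear factor. -/
lemma cubic_rpow_le {x y z s l : ℝ} (hl : 0 < l) (hx : l ≤ x) (hy : l ≤ y) (hz : l ≤ z)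
    (hs : 0 < s) {a : ℝ} (ha : 0 ≤ a) :
    cubic x y z s ^ (-a) ≤ (s + l ^ 2) ^ (-(3 * a)) := by
  have h : (s + l ^ 2) ^ 3 ≤ cubic x y z s := by
    have e : (s + l ^ 2) ^ 3 = (s + l ^ 2) * (s + l ^ 2) * (s + l ^ 2) := by ring
    rw [e, cubic]
    gcongr
  have h0 : 0 < s + l ^ 2 := by positivity
  calc cubic x y z s ^ (-a) ≤ ((s + l ^ 2) ^ 3) ^ (-a) :=
        Real.rpow_le_rpow_of_nonpos (by positivity) h (by linarith)
    _ = (s + l ^ 2) ^ (-(3 * a)) := by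
        rw [← Real.rpow_natCast, ← Real.rpow_mul h0.le]; congr 1; push_cast; ring

lemma measurable_cubic (x y z : ℝ) : Measurable (cubic x y z) := by
  unfold cubic; fun_prop

lemma exists_common_lower_bound {x y z : ℝ} (hx : 0 < x) (hy : 0 < y) (hz : 0 < z) :
    ∃ l, 0 < l ∧ l < x ∧ l < y ∧ l < z := by
  refine ⟨min x (min y z) / 2, ?_, ?_, ?_, ?_⟩
  · have : 0 < min x (min y z) := lt_min hx (lt_min hy hz)
    positivity
  all_goals
    have h1 := min_le_left x (min y z)
    have h2 := (min_le_right x (min y z)).trans (min_le_left y z)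
    have h3 := (min_le_right x (min y z)).trans (min_le_right y z)
    have : 0 < min x (min y z) := lt_min hx (lt_min hy hz)
    linarith

lemma integrableOn_shifted_rpow {l a : ℝ} (hl : 0 < l) (ha : a < -1) :
    IntegrableOn (fun s : ℝ => (s + l ^ 2) ^ a) (Set.Ioi 0) :=
  integrableOn_add_rpow_Ioi_of_lt ha (by nlinarith)

lemma integrableOn_cubic {x y z : ℝ} (hx : 0 < x) (hy : 0 < y) (hz : 0 < z) :
    IntegrableOn (fun s => cubic x y z s ^ (-(1 / 2) : ℝ)) (Set.Ioi 0) := by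
  obtain ⟨l, hl, h1, h2, h3⟩ := exists_common_lower_bound hx hy hz
  refine Integrable.mono' (integrableOn_shifted_rpow (a := -(3 * (1 / 2))) hl (by norm_num))
    ((measurable_cubic x y z).pow_const _).aestronglyMeasurable ?_
  refine (ae_restrict_iff' measurableSet_Ioi).2 (ae_of_all _ fun s hs => ?_)
  rw [Real.norm_of_nonneg (Real.rpow_nonneg (cubic_pos hx hy hz hs).le _)]
  exact cubic_rpow_le hl h1.le h2.le h3.le hs (by norm_num)

lemma integrableOn_C {x y z : ℝ} (hx : 0 < x) (hy : 0 < y) (hz : 0 < z) {n : ℕ} (hn : n ≤ 3) :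
    IntegrableOn (fun s => cubic x y z s ^ (-(3 / 2) : ℝ) * s ^ n) (Set.Ioi 0) := by
  obtain ⟨l, hl, h1, h2, h3⟩ := exists_common_lower_bound hx hy hz
  have hn' : (n : ℝ) ≤ 3 := by exact_mod_cast hn
  refine Integrable.mono' (integrableOn_shifted_rpow (a := -(3 * (3 / 2)) + n) hl (by linarith))
    (((measurable_cubic x y z).pow_const _).mul (measurable_id.pow_const n)).aestronglyMeasurable ?_
  refine (ae_restrict_iff' measurableSet_Ioi).2 (ae_of_all _ fun s hs => ?_)
  have hs : 0 < s := hs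
  have h0 : 0 < s + l ^ 2 := by positivity
  have hc := Real.rpow_nonneg (cubic_pos hx hy hz hs).le (-(3 / 2) : ℝ)
  rw [Real.norm_of_nonneg (by positivity), Real.rpow_add h0, Real.rpow_natCast]
  gcongr
  · exact cubic_rpow_le hl h1.le h2.le h3.le hs (by norm_num)
  · nlinarith

lemma C_pos {g : ℝ} (hg : 0 < g) {x y z : ℝ} (hx : 0 < x) (hy : 0 < y) (hz : 0 < z) {n : ℕ}
    (hn : n ≤ 3) : 0 < C g n x y z := by
  unfold C
  refine mul_pos (by positivity) ?_
  have hpos : ∀ s ∈ Set.Ioi (0 : ℝ), 0 < cubic x y z s ^ (-(3 / 2) : ℝ) * s ^ n := fun s hs =>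
    mul_pos (Real.rpow_pos_of_pos (cubic_pos hx hy hz hs) _) (pow_pos hs n)
  have hnn : 0 ≤ᵐ[volume.restrict (Set.Ioi (0 : ℝ))]
      fun s => cubic x y z s ^ (-(3 / 2) : ℝ) * s ^ n :=
    (ae_restrict_iff' measurableSet_Ioi).2 (ae_of_all _ fun s hs => (hpos s hs).le)
  refine (setIntegral_pos_iff_support_of_nonneg_ae hnn (integrableOn_C hx hy hz hn)).2 ?_
  have : Set.Ioi (0 : ℝ) ⊆
      Function.support (fun s => cubic x y z s ^ (-(3 / 2) : ℝ) * s ^ n) ∩ Set.Ioi 0 :=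
    fun s hs => ⟨(hpos s hs).ne', hs⟩
  exact lt_of_lt_of_le (by simp) (measure_mono this)

lemma C_swap_right (g : ℝ) (n : ℕ) (x y z : ℝ) : C g n x z y = C g n x y z := by
  unfold C; congr 2; ext s; congr 2; ring

lemma C_swap_left (g : ℝ) (n : ℕ) (x y z : ℝ) : C g n y x z = C g n x y z := by
  unfold C; congr 2; ext s; congr 2; ring

/-- The integral `∫ ds / ((s + x²) √((s + x²)(s + y²)(s + z²)))`, which gives the derivative of
the potential in the direction of the first semiaxis. -/
noncomputable def axisIntegral (x y z : ℝ) : ℝ :=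
  ∫ s in Set.Ioi (0 : ℝ), cubic x y z s ^ (-(1 / 2) : ℝ) / (s + x ^ 2)

lemma integrableOn_axis {x y z : ℝ} (hx : 0 < x) (hy : 0 < y) (hz : 0 < z) {w : ℝ} (hw : 0 < w) :
    IntegrableOn (fun s => cubic x y z s ^ (-(1 / 2) : ℝ) / (s + w ^ 2)) (Set.Ioi 0) := by
  refine Integrable.mono' ((integrableOn_cubic hx hy hz).div_const (w ^ 2))
    (((measurable_cubic x y z).pow_const _).div
      (measurable_id.add_const _)).aestronglyMeasurable ?_
  refine (ae_restrict_iff' measurableSet_Ioi).2 (ae_of_all _ fun s hs => ?_)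
  have hs : 0 < s := hs
  have hc := Real.rpow_nonneg (cubic_pos hx hy hz hs).le (-(1 / 2) : ℝ)
  rw [Real.norm_of_nonneg (by positivity)]
  gcongr
  linarith

lemma axisIntegral_swap (x y z : ℝ) : axisIntegral x z y = axisIntegral x y z := by
  have h : cubic x z y = cubic x y z := by ext s; unfold cubic; ring
  unfold axisIntegral; rw [h]

/-- Differences of the forces along the axes, expressed through the integrals `C₁` and `C₂`:
`x²/(s+x²) - z²/(s+z²) = (x²-z²) s / ((s+x²)(s+z²))`. -/
lemma axisIntegral_sub (g : ℝ) {x y z : ℝ} (hx : 0 < x) (hy : 0 < y) (hz : 0 < z) :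
    2 * Real.pi * g * (x ^ 2 * axisIntegral x y z - z ^ 2 * axisIntegral z x y)
      = (x ^ 2 - z ^ 2) * (C g 2 x y z + y ^ 2 * C g 1 x y z) := by
  have hzc : cubic z x y = cubic x y z := by ext s; unfold cubic; ring
  have key : x ^ 2 * axisIntegral x y z - z ^ 2 * axisIntegral z x y
      = (x ^ 2 - z ^ 2) * ((∫ s in Set.Ioi (0 : ℝ), cubic x y z s ^ (-(3 / 2) : ℝ) * s ^ 2)
        + y ^ 2 * ∫ s in Set.Ioi (0 : ℝ), cubic x y z s ^ (-(3 / 2) : ℝ) * s ^ 1) := by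
    unfold axisIntegral
    rw [hzc, ← integral_const_mul, ← integral_const_mul, ← integral_const_mul,
      ← integral_sub ((integrableOn_axis hx hy hz hx).const_mul _)
        ((integrableOn_axis hx hy hz hz).const_mul _),
      ← integral_add (integrableOn_C hx hy hz (by norm_num))
        ((integrableOn_C hx hy hz (by norm_num)).const_mul _), ← integral_const_mul]
    refine setIntegral_congr_fun measurableSet_Ioi fun s hs => ?_
    have hs : 0 < s := hs
    have hc := cubic_pos hx hy hz hs
    have e : cubic x y z s ^ (-(1 / 2) : ℝ) = cubic x y z s ^ (-(3 / 2) : ℝ) * cubic x y z s := by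
      rw [← Real.rpow_add_one hc.ne']; norm_num
    simp only [e]
    set r := cubic x y z s ^ (-(3 / 2) : ℝ)
    have h1 : s + x ^ 2 ≠ 0 := by positivity
    have h3 : s + z ^ 2 ≠ 0 := by positivity
    unfold cubic
    field_simp
    ring
  rw [key]; unfold C; simp only [cubic]; ring

/-- The pointwise derivative of the integrand of the potential with respect to the semiaxes. -/
noncomputable def integrandDeriv (v : ℝ × ℝ × ℝ) (s : ℝ) : ℝ × ℝ × ℝ →L[ℝ] ℝ :=
  let r := cubic v.1 v.2.1 v.2.2 s ^ (-(1 / 2) : ℝ)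
  (-(v.1 * (r / (s + v.1 ^ 2)))) • ContinuousLinearMap.fst ℝ ℝ (ℝ × ℝ)
    + (-(v.2.1 * (r / (s + v.2.1 ^ 2)))) •
      (ContinuousLinearMap.fst ℝ ℝ ℝ).comp (ContinuousLinearMap.snd ℝ ℝ (ℝ × ℝ))
    + (-(v.2.2 * (r / (s + v.2.2 ^ 2)))) •
      (ContinuousLinearMap.snd ℝ ℝ ℝ).comp (ContinuousLinearMap.snd ℝ ℝ (ℝ × ℝ))

lemma hasFDerivAt_integrand {v : ℝ × ℝ × ℝ} (h1 : 0 < v.1) (h2 : 0 < v.2.1) (h3 : 0 < v.2.2)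
    {s : ℝ} (hs : 0 < s) :
    HasFDerivAt (fun v : ℝ × ℝ × ℝ => cubic v.1 v.2.1 v.2.2 s ^ (-(1 / 2) : ℝ))
      (integrandDeriv v s) v := by
  have hc := cubic_pos h1 h2 h3 hs
  have d1 : HasFDerivAt (fun v : ℝ × ℝ × ℝ => v.1) (ContinuousLinearMap.fst ℝ ℝ (ℝ × ℝ)) v :=
    hasFDerivAt_fst
  have d2 : HasFDerivAt (fun v : ℝ × ℝ × ℝ => v.2.1)
      ((ContinuousLinearMap.fst ℝ ℝ ℝ).comp (ContinuousLinearMap.snd ℝ ℝ (ℝ × ℝ))) v :=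
    hasFDerivAt_fst.comp v hasFDerivAt_snd
  have d3 : HasFDerivAt (fun v : ℝ × ℝ × ℝ => v.2.2)
      ((ContinuousLinearMap.snd ℝ ℝ ℝ).comp (ContinuousLinearMap.snd ℝ ℝ (ℝ × ℝ))) v :=
    hasFDerivAt_snd.comp v hasFDerivAt_snd
  have dc : HasFDerivAt (fun v : ℝ × ℝ × ℝ => cubic v.1 v.2.1 v.2.2 s) _ v :=
    (((d1.pow 2).const_add s).mul ((d2.pow 2).const_add s)).mul ((d3.pow 2).const_add s)
  have d := dc.rpow_const (p := (-(1 / 2) : ℝ)) (Or.inl hc.ne')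
  refine d.congr_fderiv ?_
  have e : cubic v.1 v.2.1 v.2.2 s ^ (-(1 / 2) : ℝ)
      = cubic v.1 v.2.1 v.2.2 s ^ (-(1 / 2) - 1 : ℝ) * cubic v.1 v.2.1 v.2.2 s := by
    rw [← Real.rpow_add_one hc.ne']; norm_num
  have n1 : s + v.1 ^ 2 ≠ 0 := by positivity
  have n2 : s + v.2.1 ^ 2 ≠ 0 := by positivity
  have n3 : s + v.2.2 ^ 2 ≠ 0 := by positivity
  refine ContinuousLinearMap.ext fun w => ?_
  unfold integrandDeriv
  simp only [e]
  generalize cubic v.1 v.2.1 v.2.2 s ^ (-(1 / 2) - 1 : ℝ) = r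
  simp [cubic]
  field_simp
  ring

lemma norm_integrandDeriv_le {v : ℝ × ℝ × ℝ} {l : ℝ} (hl : 0 < l) (h1 : l < v.1) (h2 : l < v.2.1)
    (h3 : l < v.2.2) {s : ℝ} (hs : 0 < s) :
    ‖integrandDeriv v s‖ ≤ 3 / l * (s + l ^ 2) ^ (-(3 * (1 / 2)) : ℝ) := by
  have p1 := hl.trans h1
  have p2 := hl.trans h2
  have p3 := hl.trans h3
  have hr0 := Real.rpow_nonneg (cubic_pos p1 p2 p3 hs).le (-(1 / 2) : ℝ)
  have hr := cubic_rpow_le hl h1.le h2.le h3.le hs (a := 1 / 2) (by norm_num)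
  set r := cubic v.1 v.2.1 v.2.2 s ^ (-(1 / 2) : ℝ) with hrdef
  set q := (s + l ^ 2) ^ (-(3 * (1 / 2)) : ℝ)
  have hterm : ∀ w : ℝ, l < w → ‖-(w * (r / (s + w ^ 2)))‖ ≤ q / l := by
    intro w hw
    have hw0 := hl.trans hw
    rw [norm_neg, Real.norm_of_nonneg (by positivity)]
    have : w * (r / (s + w ^ 2)) ≤ r / l := by
      rw [mul_div_assoc', div_le_div_iff₀ (by positivity) hl]
      nlinarith [mul_nonneg hr0 (mul_nonneg hw0.le (sub_nonneg.2 hw.le)), mul_nonneg hr0 hs.le]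
    exact this.trans (by gcongr)
  have n1 : ‖ContinuousLinearMap.fst ℝ ℝ (ℝ × ℝ)‖ ≤ 1 := ContinuousLinearMap.norm_fst_le ..
  have n2 : ‖(ContinuousLinearMap.fst ℝ ℝ ℝ).comp (ContinuousLinearMap.snd ℝ ℝ (ℝ × ℝ))‖ ≤ 1 :=
    (ContinuousLinearMap.opNorm_comp_le _ _).trans (mul_le_one₀
      (ContinuousLinearMap.norm_fst_le ..) (norm_nonneg _) (ContinuousLinearMap.norm_snd_le ..))
  have n3 : ‖(ContinuousLinearMap.snd ℝ ℝ ℝ).comp (ContinuousLinearMap.snd ℝ ℝ (ℝ × ℝ))‖ ≤ 1 :=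
    (ContinuousLinearMap.opNorm_comp_le _ _).trans (mul_le_one₀
      (ContinuousLinearMap.norm_snd_le ..) (norm_nonneg _) (ContinuousLinearMap.norm_snd_le ..))
  have hq : 0 ≤ q / l := div_nonneg (hr0.trans hr) hl.le
  have hsmul : ∀ (w : ℝ) (L : ℝ × ℝ × ℝ →L[ℝ] ℝ), l < w → ‖L‖ ≤ 1 →
      ‖(-(w * (r / (s + w ^ 2)))) • L‖ ≤ q / l := fun w L hw hL => by
    rw [norm_smul]
    calc _ ≤ q / l * 1 := mul_le_mul (hterm w hw) hL (norm_nonneg _) hq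
      _ = _ := mul_one _
  have := norm_add_le_of_le
    (norm_add_le_of_le (hsmul _ _ h1 n1) (hsmul _ _ h2 n2)) (hsmul _ _ h3 n3)
  unfold integrandDeriv
  simp only [← hrdef]
  refine this.trans (le_of_eq ?_)
  ring

/-- Differentiation of the potential under the integral sign. -/
lemma hasFDerivAt_potential (g : ℝ) {v : ℝ × ℝ × ℝ} (h1 : 0 < v.1) (h2 : 0 < v.2.1)
    (h3 : 0 < v.2.2) :
    HasFDerivAt (fun v : ℝ × ℝ × ℝ => potential g v.1 v.2.1 v.2.2)
      ((-2 * Real.pi * g) • ∫ s in Set.Ioi (0 : ℝ), integrandDeriv v s) v := by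
  obtain ⟨l, hl, l1, l2, l3⟩ := exists_common_lower_bound h1 h2 h3
  have hU : {w : ℝ × ℝ × ℝ | l < w.1 ∧ l < w.2.1 ∧ l < w.2.2} ∈ nhds v := by
    refine IsOpen.mem_nhds ?_ ⟨l1, l2, l3⟩
    exact (isOpen_lt continuous_const continuous_fst).inter
      ((isOpen_lt continuous_const (continuous_fst.comp continuous_snd)).inter
        (isOpen_lt continuous_const (continuous_snd.comp continuous_snd)))
  refine HasFDerivAt.const_smul
    (f := fun v : ℝ × ℝ × ℝ => ∫ s in Set.Ioi (0 : ℝ), cubic v.1 v.2.1 v.2.2 s ^ (-(1 / 2) : ℝ))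
    ?_ (-2 * Real.pi * g)
  refine hasFDerivAt_integral_of_dominated_of_fderiv_le
    (bound := fun s => 3 / l * (s + l ^ 2) ^ (-(3 * (1 / 2)) : ℝ)) hU
    (Filter.Eventually.of_forall fun w =>
      ((measurable_cubic _ _ _).pow_const _).aestronglyMeasurable)
    (integrableOn_cubic h1 h2 h3) ?_ ?_
    ((integrableOn_shifted_rpow hl (by norm_num)).const_mul _) ?_
  · have hm : ∀ w : ℝ, Measurable fun s : ℝ =>
        -(w * (cubic v.1 v.2.1 v.2.2 s ^ (-(1 / 2) : ℝ) / (s + w ^ 2))) := fun w =>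
      ((((measurable_cubic _ _ _).pow_const _).div
        (measurable_id.add_const _)).const_mul _).neg
    exact (((hm _).aestronglyMeasurable.smul_const _).add
      ((hm _).aestronglyMeasurable.smul_const _)).add ((hm _).aestronglyMeasurable.smul_const _)
  · exact (ae_restrict_iff' measurableSet_Ioi).2 (ae_of_all _ fun s hs w hw =>
      norm_integrandDeriv_le hl hw.1 hw.2.1 hw.2.2 hs)
  · exact (ae_restrict_iff' measurableSet_Ioi).2 (ae_of_all _ fun s hs w hw =>
      hasFDerivAt_integrand (hl.trans hw.1) (hl.trans hw.2.1) (hl.trans hw.2.2) hs)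

/-- The derivative of the potential along a curve of semiaxes. -/
lemma hasDerivAt_potential (g : ℝ) {x y z : ℝ → ℝ} {x' y' z' t : ℝ} (hx : HasDerivAt x x' t)
    (hy : HasDerivAt y y' t) (hz : HasDerivAt z z' t) (h1 : 0 < x t) (h2 : 0 < y t)
    (h3 : 0 < z t) :
    HasDerivAt (fun t => potential g (x t) (y t) (z t))
      (2 * Real.pi * g * (x t * x' * axisIntegral (x t) (y t) (z t)
        + y t * y' * axisIntegral (y t) (z t) (x t)
        + z t * z' * axisIntegral (z t) (x t) (y t))) t := by
  have hd := (hasFDerivAt_potential g (v := (x t, y t, z t)) h1 h2 h3).comp_hasDerivAt t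
    (hx.prodMk (hy.prodMk hz))
  refine hd.congr_deriv ?_
  have c2 : cubic (y t) (z t) (x t) = cubic (x t) (y t) (z t) := by ext s; unfold cubic; ring
  have c3 : cubic (z t) (x t) (y t) = cubic (x t) (y t) (z t) := by ext s; unfold cubic; ring
  have i1 := integrableOn_axis h1 h2 h3 h1
  have i2 := integrableOn_axis h1 h2 h3 h2
  have i3 := integrableOn_axis h1 h2 h3 h3
  have e : (∫ s in Set.Ioi (0 : ℝ), integrandDeriv (x t, y t, z t) s)
      = (-(x t * axisIntegral (x t) (y t) (z t))) • ContinuousLinearMap.fst ℝ ℝ (ℝ × ℝ)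
    + (-(y t * axisIntegral (y t) (z t) (x t))) •
      (ContinuousLinearMap.fst ℝ ℝ ℝ).comp (ContinuousLinearMap.snd ℝ ℝ (ℝ × ℝ))
    + (-(z t * axisIntegral (z t) (x t) (y t))) •
      (ContinuousLinearMap.snd ℝ ℝ ℝ).comp (ContinuousLinearMap.snd ℝ ℝ (ℝ × ℝ)) := by
    unfold integrandDeriv axisIntegral
    simp only [c2, c3]
    rw [integral_add, integral_add, integral_smul_const, integral_smul_const, integral_smul_const,
      integral_neg, integral_neg, integral_neg, integral_const_mul, integral_const_mul,
      integral_const_mul]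
    · exact (i1.const_mul _).neg.smul_const _
    · exact (i2.const_mul _).neg.smul_const _
    · exact ((i1.const_mul _).neg.smul_const _).add ((i2.const_mul _).neg.smul_const _)
    · exact (i3.const_mul _).neg.smul_const _
  rw [e]
  simp
  ring

/-! ### Equilibria as solutions of algebraic equations -/

/-- The semiaxes of a point of the configuration space are ordered and have product one. -/
lemma semiaxes_of_mem {b : V2} (hb : b ∈ configSpace) :
    0 < b₃ b ∧ b₃ b < b₂ b ∧ b₂ b < b₁ b ∧ b₁ b * b₂ b * b₃ b = 1 := by
  obtain ⟨h1, h21, h2⟩ := hb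
  have hr : 0 < b₁ b ^ (-(1 / 2) : ℝ) := Real.rpow_pos_of_pos h1 _
  have h2' : 0 < b₂ b := hr.trans h2
  have hsq : b₁ b ^ (-(1 / 2) : ℝ) * b₁ b ^ (-(1 / 2) : ℝ) = (b₁ b)⁻¹ := by
    rw [← Real.rpow_add h1, ← Real.rpow_neg_one]; norm_num
  have hlt : (b₁ b)⁻¹ < b₂ b * b₂ b := hsq ▸ mul_lt_mul'' h2 h2 hr.le hr.le
  have h12 : 0 < b₁ b * b₂ b := mul_pos h1 h2'
  have e3 : b₃ b = 1 / (b₁ b * b₂ b) := rfl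
  refine ⟨e3 ▸ by positivity, ?_, h21, ?_⟩
  · rw [e3, div_lt_iff₀ h12]
    have := mul_lt_mul_of_pos_left hlt h1
    rw [mul_inv_cancel₀ h1.ne'] at this
    linarith
  · rw [e3]; field_simp

/-- The rotational kinetic energy due to the components `m`, `n` of the two momenta along an axis,
when the other two semiaxes are `y` and `z`. -/
noncomputable def axisEnergy (y z m n : ℝ) : ℝ :=
  (y ^ 2 + z ^ 2) / (y ^ 2 - z ^ 2) ^ 2 * ((m ^ 2 + n ^ 2) / 2)
    + 2 * y * z / (y ^ 2 - z ^ 2) ^ 2 * (m * n)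

/-- The kinetic energy of the semiaxes. -/
noncomputable def stretchEnergy (x y z c d : ℝ) : ℝ :=
  (x ^ 2 * (y ^ 2 + z ^ 2) * c ^ 2 - 2 * z * (c * d) + y ^ 2 * (x ^ 2 + z ^ 2) * d ^ 2) / 2
    / (y ^ 2 * z ^ 2 + x ^ 2 * z ^ 2 + x ^ 2 * y ^ 2)

lemma hamiltonian_eq (g : ℝ) (p : Phase) :
    hamiltonian g p = stretchEnergy (b₁ p.1) (b₂ p.1) (b₃ p.1) (p.2.1 0) (p.2.1 1)
      + (axisEnergy (b₂ p.1) (b₃ p.1) (p.2.2.1 0) (p.2.2.2 0)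
        + axisEnergy (b₁ p.1) (b₃ p.1) (p.2.2.1 1) (p.2.2.2 1)
        + axisEnergy (b₁ p.1) (b₂ p.1) (p.2.2.1 2) (p.2.2.2 2))
      + potential g (b₁ p.1) (b₂ p.1) (b₃ p.1) := by
  simp [hamiltonian, K, J₁, J₂, mulVec, dotProduct, Fin.sum_univ_succ, axisEnergy, stretchEnergy,
    diagonal]
  ring

lemma differentiableAt_axisEnergy {E : Type*} [NormedAddCommGroup E] [NormedSpace ℝ E]
    {y z m n : E → ℝ} {p : E} (hy : DifferentiableAt ℝ y p) (hz : DifferentiableAt ℝ z p)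
    (hm : DifferentiableAt ℝ m p) (hn : DifferentiableAt ℝ n p) (h : y p ^ 2 - z p ^ 2 ≠ 0) :
    DifferentiableAt ℝ (fun p => axisEnergy (y p) (z p) (m p) (n p)) p := by
  have h' : (y p ^ 2 - z p ^ 2) ^ 2 ≠ 0 := pow_ne_zero 2 h
  unfold axisEnergy
  fun_prop (disch := assumption)

lemma differentiableAt_hamiltonian (g : ℝ) {p : Phase} (hp : p.1 ∈ configSpace) :
    DifferentiableAt ℝ (hamiltonian g) p := by
  obtain ⟨h3, h32, h21, hprod⟩ := semiaxes_of_mem hp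
  have h2 := h3.trans h32
  have h1 := h2.trans h21
  have d1 : DifferentiableAt ℝ (fun p : Phase => b₁ p.1) p := by unfold b₁; fun_prop
  have d2 : DifferentiableAt ℝ (fun p : Phase => b₂ p.1) p := by unfold b₂; fun_prop
  have d3 : DifferentiableAt ℝ (fun p : Phase => b₃ p.1) p := by
    have : b₁ p.1 * b₂ p.1 ≠ 0 := (mul_pos h1 h2).ne'
    change DifferentiableAt ℝ (fun p : Phase => 1 / (b₁ p.1 * b₂ p.1)) p
    fun_prop (disch := assumption)
  rw [funext (hamiltonian_eq g)]
  refine ((?_ : DifferentiableAt ℝ _ p).add (((?_ : DifferentiableAt ℝ _ p).add ?_).add ?_)).add ?_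
  · have : b₂ p.1 ^ 2 * b₃ p.1 ^ 2 + b₁ p.1 ^ 2 * b₃ p.1 ^ 2 + b₁ p.1 ^ 2 * b₂ p.1 ^ 2 ≠ 0 := by
      positivity
    unfold stretchEnergy
    fun_prop (disch := assumption)
  · exact differentiableAt_axisEnergy d2 d3 (by fun_prop) (by fun_prop) (by nlinarith)
  · exact differentiableAt_axisEnergy d1 d3 (by fun_prop) (by fun_prop) (by nlinarith)
  · exact differentiableAt_axisEnergy d1 d2 (by fun_prop) (by fun_prop) (by nlinarith)
  · have hV := (hasFDerivAt_potential g (v := (b₁ p.1, b₂ p.1, b₃ p.1)) h1 h2 h3).differentiableAt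
    exact DifferentiableAt.comp (g := fun v : ℝ × ℝ × ℝ => potential g v.1 v.2.1 v.2.2)
      (f := fun p : Phase => (b₁ p.1, b₂ p.1, b₃ p.1)) p hV (d1.prodMk (d2.prodMk d3))

/-- An equilibrium is a critical point of the Hamiltonian on the reduced space. -/
lemma isEquilibrium_iff_fderiv (g : ℝ) (p : Phase) :
    IsEquilibrium g p ↔ ∀ Y, fderiv ℝ (hamiltonian g) p (tangent p Y) = 0 := by
  constructor
  · rintro ⟨X, hX, h0⟩ Y
    rw [← hX Y]
    simp only [tangent, Prod.mk_eq_zero] at h0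
    obtain ⟨hv, hw, hl, hr⟩ := h0
    -- `m · (ω × ω') = (m × ω) · ω'`
    rw [symplecticForm, hv, hw, triple_product_permutation, triple_product_permutation,
      triple_product_permutation p.2.2.2, triple_product_permutation X.2.2.2, hl, hr]
    simp
  · intro h
    refine ⟨0, fun Y => ?_, by simp [tangent]⟩
    rw [h Y]
    simp [symplecticForm]

/-- The vector `(J₁ + J₂) (m_l + m_r)`, the sum of the velocities of the two factors. -/
noncomputable def sumVelocity (b : V2) (m : V3 × V3) : V3 :=
  ![(m.1 0 + m.2 0) / (b₂ b - b₃ b) ^ 2, (m.1 1 + m.2 1) / (b₁ b - b₃ b) ^ 2,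
    (m.1 2 + m.2 2) / (b₁ b - b₂ b) ^ 2]

/-- The vector `(J₁ - J₂) (m_l - m_r)`, the difference of the velocities of the two factors. -/
noncomputable def diffVelocity (b : V2) (m : V3 × V3) : V3 :=
  ![(m.1 0 - m.2 0) / (b₂ b + b₃ b) ^ 2, (m.1 1 - m.2 1) / (b₁ b + b₃ b) ^ 2,
    (m.1 2 - m.2 2) / (b₁ b + b₂ b) ^ 2]

/-- The condition that the velocity of either factor is parallel to the momentum, in the plane of
the axes of lengths `x` and `y`; `z` is the third semiaxis. The sum and difference velocities are
`a`, `a'` along the first axis and `c`, `c'` along the second. -/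
def PairRelation (x y z a a' c c' : ℝ) : Prop :=
  (x + y - 2 * z) * (a * c) + (x + y + 2 * z) * (a' * c') = 0 ∧
    (x - y + 2 * z) * (a * c') + (x - y - 2 * z) * (a' * c) = 0

/-- The centrifugal force along the axis of length `x`, multiplied by `x`, when the velocities are
`c`, `c'` along the axis of length `y` and `d`, `d'` along the axis of length `z`. -/
noncomputable def axisForce (x y z c c' d d' : ℝ) : ℝ :=
  x / 2 * ((x - z) * c ^ 2 + (x + z) * c' ^ 2 + (x - y) * d ^ 2 + (x + y) * d' ^ 2)

/-- Balance of centrifugal and gravitational forces; `P` and `Q` are the integrals `C₁`, `C₂`. -/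
def Balance (P Q x y z a a' c c' d d' : ℝ) : Prop :=
  axisForce x y z c c' d d' - axisForce z x y a a' c c' = (x ^ 2 - z ^ 2) * (Q + y ^ 2 * P) ∧
    axisForce y x z a a' d d' - axisForce z x y a a' c c' = (y ^ 2 - z ^ 2) * (Q + x ^ 2 * P)

/-- The algebraic form of the equilibrium equations, in terms of the velocities `u` and `v`. -/
def IsSteady (P Q x y z : ℝ) (u v : V3) : Prop :=
  PairRelation x y z (u 0) (v 0) (u 1) (v 1) ∧ PairRelation x z y (u 0) (v 0) (u 2) (v 2) ∧
    PairRelation y z x (u 1) (v 1) (u 2) (v 2) ∧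
    Balance P Q x y z (u 0) (v 0) (u 1) (v 1) (u 2) (v 2)

/-- The derivative of the rotational energy at fixed momenta, expressed through the velocities. -/
lemma hasDerivAt_axisEnergy {y z : ℝ → ℝ} {y' z' t : ℝ} (hy : HasDerivAt y y' t)
    (hz : HasDerivAt z z' t) (hs : y t - z t ≠ 0) (ha : y t + z t ≠ 0) (m n : ℝ) :
    HasDerivAt (fun t => axisEnergy (y t) (z t) m n)
      (-(1 / 2) * ((y t - z t) * (y' - z') * ((m + n) / (y t - z t) ^ 2) ^ 2
        + (y t + z t) * (y' + z') * ((m - n) / (y t + z t) ^ 2) ^ 2)) t := by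
  have hd : y t ^ 2 - z t ^ 2 = (y t - z t) * (y t + z t) := by ring
  have hd0 : (y t ^ 2 - z t ^ 2) ^ 2 ≠ 0 := hd ▸ pow_ne_zero 2 (mul_ne_zero hs ha)
  have hD : HasDerivAt (fun t => (y t ^ 2 - z t ^ 2) ^ 2) _ t := ((hy.pow 2).sub (hz.pow 2)).pow 2
  have h1 : HasDerivAt (fun t => y t ^ 2 + z t ^ 2) _ t := (hy.pow 2).add (hz.pow 2)
  have h2 : HasDerivAt (fun t => 2 * y t * z t) _ t := (hy.const_mul 2).mul hz
  refine (((h1.div hD hd0).mul_const _).add ((h2.div hD hd0).mul_const _)).congr_deriv ?_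
  simp
  rw [hd]
  field_simp
  ring

lemma hasDerivAt_axisEnergy_momenta {y z : ℝ} (hs : y - z ≠ 0) (ha : y + z ≠ 0)
    (m n m' n' : ℝ) :
    HasDerivAt (fun t : ℝ => axisEnergy y z (m + t * m') (n + t * n'))
      (1 / 2 * (m' * ((m + n) / (y - z) ^ 2 + (m - n) / (y + z) ^ 2)
        + n' * ((m + n) / (y - z) ^ 2 - (m - n) / (y + z) ^ 2))) 0 := by
  have hd : y ^ 2 - z ^ 2 = (y - z) * (y + z) := by ring
  have hm : HasDerivAt (fun t : ℝ => m + t * m') (1 * m') 0 :=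
    ((hasDerivAt_id 0).mul_const m').const_add m
  have hn : HasDerivAt (fun t : ℝ => n + t * n') (1 * n') 0 :=
    ((hasDerivAt_id 0).mul_const n').const_add n
  refine ((((hm.pow 2).add (hn.pow 2)).div_const 2 |>.const_mul _).add
    ((hm.mul hn).const_mul _)).congr_deriv ?_
  simp
  rw [hd]
  field_simp
  ring

lemma fderiv_eq_of_hasDerivAt {g : ℝ} {p : Phase} (hp : p.1 ∈ configSpace) {Y : Phase} {d : ℝ}
    (h : HasDerivAt (fun t : ℝ => hamiltonian g (p + t • Y)) d 0) :
    fderiv ℝ (hamiltonian g) p Y = d := by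
  rw [← (differentiableAt_hamiltonian g hp).lineDeriv_eq_fderiv]
  exact HasLineDerivAt.lineDeriv h

lemma fderiv_hamiltonian_momenta (g : ℝ) {p : Phase} (hp : p.1 ∈ configSpace) (δ : V3 × V3) :
    fderiv ℝ (hamiltonian g) p (0, 0, δ) = 1 / 2 *
      (δ.1 ⬝ᵥ (sumVelocity p.1 p.2.2 + diffVelocity p.1 p.2.2)
        + δ.2 ⬝ᵥ (sumVelocity p.1 p.2.2 - diffVelocity p.1 p.2.2)) := by
  obtain ⟨h3, h32, h21, -⟩ := semiaxes_of_mem hp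
  refine fderiv_eq_of_hasDerivAt hp ?_
  have e : (fun t : ℝ => hamiltonian g (p + t • ((0, 0, δ) : Phase))) = fun t =>
      stretchEnergy (b₁ p.1) (b₂ p.1) (b₃ p.1) (p.2.1 0) (p.2.1 1)
      + (axisEnergy (b₂ p.1) (b₃ p.1) (p.2.2.1 0 + t * δ.1 0) (p.2.2.2 0 + t * δ.2 0)
        + axisEnergy (b₁ p.1) (b₃ p.1) (p.2.2.1 1 + t * δ.1 1) (p.2.2.2 1 + t * δ.2 1)
        + axisEnergy (b₁ p.1) (b₂ p.1) (p.2.2.1 2 + t * δ.1 2) (p.2.2.2 2 + t * δ.2 2))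
      + potential g (b₁ p.1) (b₂ p.1) (b₃ p.1) := by
    ext t; rw [hamiltonian_eq]; simp
  rw [e]
  refine ((((hasDerivAt_axisEnergy_momenta ?_ ?_ _ _ _ _).add
    (hasDerivAt_axisEnergy_momenta ?_ ?_ _ _ _ _)).add
    (hasDerivAt_axisEnergy_momenta ?_ ?_ _ _ _ _)).const_add _ |>.add_const _).congr_deriv ?_
  any_goals linarith
  simp [sumVelocity, diffVelocity, dotProduct, Fin.sum_univ_three]
  ring

lemma fderiv_hamiltonian_stretch (g : ℝ) {p : Phase} (hp : p.1 ∈ configSpace) (w : V2) :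
    fderiv ℝ (hamiltonian g) p (0, w, 0) =
      (b₁ p.1 ^ 2 * (b₂ p.1 ^ 2 + b₃ p.1 ^ 2) * (p.2.1 0 * w 0)
        - b₃ p.1 * (p.2.1 0 * w 1 + p.2.1 1 * w 0)
        + b₂ p.1 ^ 2 * (b₁ p.1 ^ 2 + b₃ p.1 ^ 2) * (p.2.1 1 * w 1))
      / (b₂ p.1 ^ 2 * b₃ p.1 ^ 2 + b₁ p.1 ^ 2 * b₃ p.1 ^ 2 + b₁ p.1 ^ 2 * b₂ p.1 ^ 2) := by
  refine fderiv_eq_of_hasDerivAt hp ?_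
  have e : (fun t : ℝ => hamiltonian g (p + t • ((0, w, 0) : Phase))) = fun t =>
      stretchEnergy (b₁ p.1) (b₂ p.1) (b₃ p.1) (p.2.1 0 + t * w 0) (p.2.1 1 + t * w 1)
      + (axisEnergy (b₂ p.1) (b₃ p.1) (p.2.2.1 0) (p.2.2.2 0)
        + axisEnergy (b₁ p.1) (b₃ p.1) (p.2.2.1 1) (p.2.2.2 1)
        + axisEnergy (b₁ p.1) (b₂ p.1) (p.2.2.1 2) (p.2.2.2 2))
      + potential g (b₁ p.1) (b₂ p.1) (b₃ p.1) := by
    ext t; rw [hamiltonian_eq]; simp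
  rw [e]
  have h : ∀ i, HasDerivAt (fun t : ℝ => p.2.1 i + t * w i) (1 * w i) 0 := fun i =>
    ((hasDerivAt_id 0).mul_const (w i)).const_add _
  refine (((((((h 0).pow 2).const_mul _).sub (((h 0).mul (h 1)).const_mul _)).add
    (((h 1).pow 2).const_mul _)).div_const 2).div_const _ |>.add_const _
    |>.add_const _).congr_deriv ?_
  simp
  ring

lemma fderiv_hamiltonian_semiaxes (g : ℝ) {b : V2} (hb : b ∈ configSpace) (m : V3 × V3) (v : V2) :
    fderiv ℝ (hamiltonian g) (b, 0, m) (v, 0, 0) =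
      -(v 0 / b₁ b * (axisForce (b₁ b) (b₂ b) (b₃ b) (sumVelocity b m 1) (diffVelocity b m 1)
          (sumVelocity b m 2) (diffVelocity b m 2)
        - axisForce (b₃ b) (b₁ b) (b₂ b) (sumVelocity b m 0) (diffVelocity b m 0)
          (sumVelocity b m 1) (diffVelocity b m 1)
        - (b₁ b ^ 2 - b₃ b ^ 2) *
          (C g 2 (b₁ b) (b₂ b) (b₃ b) + b₂ b ^ 2 * C g 1 (b₁ b) (b₂ b) (b₃ b))))
      - v 1 / b₂ b * (axisForce (b₂ b) (b₁ b) (b₃ b) (sumVelocity b m 0) (diffVelocity b m 0)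
          (sumVelocity b m 2) (diffVelocity b m 2)
        - axisForce (b₃ b) (b₁ b) (b₂ b) (sumVelocity b m 0) (diffVelocity b m 0)
          (sumVelocity b m 1) (diffVelocity b m 1)
        - (b₂ b ^ 2 - b₃ b ^ 2) *
          (C g 2 (b₁ b) (b₂ b) (b₃ b) + b₁ b ^ 2 * C g 1 (b₁ b) (b₂ b) (b₃ b))) := by
  obtain ⟨h3, h32, h21, -⟩ := semiaxes_of_mem hb
  have h2 := h3.trans h32
  have h1 := h2.trans h21
  refine fderiv_eq_of_hasDerivAt (p := (b, 0, m)) hb ?_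
  have e : (fun t : ℝ => hamiltonian g ((b, 0, m) + t • ((v, 0, 0) : Phase))) = fun t =>
      (axisEnergy (b₂ (b + t • v)) (b₃ (b + t • v)) (m.1 0) (m.2 0)
        + axisEnergy (b₁ (b + t • v)) (b₃ (b + t • v)) (m.1 1) (m.2 1)
        + axisEnergy (b₁ (b + t • v)) (b₂ (b + t • v)) (m.1 2) (m.2 2))
      + potential g (b₁ (b + t • v)) (b₂ (b + t • v)) (b₃ (b + t • v)) := by
    ext t; rw [hamiltonian_eq]; simp [stretchEnergy]
  rw [e]
  have hv : b + (0 : ℝ) • v = b := by simp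
  have d1 : HasDerivAt (fun t : ℝ => b₁ (b + t • v)) (v 0) 0 := by
    have : HasDerivAt (fun t : ℝ => b 0 + t * v 0) (1 * v 0) 0 :=
      ((hasDerivAt_id (0 : ℝ)).mul_const (v 0)).const_add (b 0)
    exact this.congr_deriv (one_mul _)
  have d2 : HasDerivAt (fun t : ℝ => b₂ (b + t • v)) (v 1) 0 := by
    have : HasDerivAt (fun t : ℝ => b 1 + t * v 1) (1 * v 1) 0 :=
      ((hasDerivAt_id (0 : ℝ)).mul_const (v 1)).const_add (b 1)
    exact this.congr_deriv (one_mul _)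
  have d3 : HasDerivAt (fun t : ℝ => b₃ (b + t • v))
      (-(b₃ b * (v 0 / b₁ b + v 1 / b₂ b))) 0 := by
    have e3 : b₃ b = 1 / (b₁ b * b₂ b) := rfl
    refine ((hasDerivAt_const (0 : ℝ) (1 : ℝ)).div (d1.mul d2) ?_).congr_deriv ?_
    · simpa only [hv, Pi.mul_apply] using (mul_pos h1 h2).ne'
    · simp only [hv, Pi.mul_apply, e3]
      field_simp
      ring
  refine ((((hasDerivAt_axisEnergy d2 d3 ?_ ?_ _ _).add
    (hasDerivAt_axisEnergy d1 d3 ?_ ?_ _ _)).add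
    (hasDerivAt_axisEnergy d1 d2 ?_ ?_ _ _)).add
    (hasDerivAt_potential g d1 d2 d3 ?_ ?_ ?_)).congr_deriv ?_
  any_goals (rw [hv]; first | assumption | linarith)
  simp only [hv]
  have i1 := axisIntegral_sub g h1 h2 h3
  have i2 := axisIntegral_sub g h2 h1 h3
  rw [C_swap_left g 2 (b₁ b), C_swap_left g 1 (b₁ b)] at i2
  rw [axisIntegral_swap (b₃ b) (b₁ b) (b₂ b), ← axisIntegral_swap (b₂ b)] at i2
  rw [mul_sub, mul_sub, ← i1, mul_sub, mul_sub, ← i2]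
  simp only [axisForce, sumVelocity, diffVelocity, cons_val_zero, cons_val_one, cons_val]
  generalize axisIntegral (b₁ b) (b₂ b) (b₃ b) = i₁
  generalize axisIntegral (b₂ b) (b₃ b) (b₁ b) = i₂
  generalize axisIntegral (b₃ b) (b₁ b) (b₂ b) = i₃
  generalize (m.1 0 + m.2 0) / (b₂ b - b₃ b) ^ 2 = u₀
  generalize (m.1 1 + m.2 1) / (b₁ b - b₃ b) ^ 2 = u₁
  generalize (m.1 2 + m.2 2) / (b₁ b - b₂ b) ^ 2 = u₂
  generalize (m.1 0 - m.2 0) / (b₂ b + b₃ b) ^ 2 = v₀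
  generalize (m.1 1 - m.2 1) / (b₁ b + b₃ b) ^ 2 = v₁
  generalize (m.1 2 - m.2 2) / (b₁ b + b₂ b) ^ 2 = v₂
  clear i1 i2 d1 d2 d3 e hv
  generalize b₁ b = x at *
  generalize b₂ b = y at *
  generalize b₃ b = z at *
  have hx : x ≠ 0 := h1.ne'
  have hy : y ≠ 0 := h2.ne'
  field_simp
  ring

/-- The kinetic energy of the semiaxes is a positive definite quadratic form. -/
lemma stretch_form_eq_zero {x y z c d : ℝ} (hx : 0 < x) (hy : 0 < y) (hz : 0 < z)
    (hprod : x * y * z = 1)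
    (h : x ^ 2 * (y ^ 2 + z ^ 2) * (c * c) - z * (c * d + d * c)
      + y ^ 2 * (x ^ 2 + z ^ 2) * (d * d) = 0) : c = 0 ∧ d = 0 := by
  -- `x²(y²+z²) · y²(x²+z²)` exceeds `z²`, because it contains the term `z² (xyz)²`
  have hdet : 0 < x ^ 2 * (y ^ 2 + z ^ 2) * (y ^ 2 * (x ^ 2 + z ^ 2)) - z ^ 2 := by
    have e : x ^ 2 * (y ^ 2 + z ^ 2) * (y ^ 2 * (x ^ 2 + z ^ 2)) - z ^ 2
        = x ^ 4 * y ^ 4 + x ^ 2 * y ^ 4 * z ^ 2 + x ^ 4 * y ^ 2 * z ^ 2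
          + ((x * y * z) ^ 2 - 1) * z ^ 2 := by ring
    rw [e, hprod]
    have : 0 < x ^ 4 * y ^ 4 + x ^ 2 * y ^ 4 * z ^ 2 + x ^ 4 * y ^ 2 * z ^ 2 := by positivity
    linarith
  have hA : 0 < x ^ 2 * (y ^ 2 + z ^ 2) := by positivity
  generalize x ^ 2 * (y ^ 2 + z ^ 2) = A at *
  generalize y ^ 2 * (x ^ 2 + z ^ 2) = B at *
  have hsq : (A * c - z * d) ^ 2 + (A * B - z ^ 2) * d ^ 2 = 0 := by linear_combination A * h
  have hd : d = 0 := by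
    by_contra hd
    have : 0 < d ^ 2 := by positivity
    nlinarith [sq_nonneg (A * c - z * d), mul_pos hdet this]
  subst hd
  have : A * c * (A * c) = 0 := by linear_combination hsq
  have := mul_self_eq_zero.1 this
  exact ⟨(mul_eq_zero.1 this).resolve_left hA.ne', rfl⟩

/-- The momenta in terms of the velocities. -/
lemma momenta_eq {b : V2} (hb : b ∈ configSpace) (m : V3 × V3) :
    m.1 0 + m.2 0 = (b₂ b - b₃ b) ^ 2 * sumVelocity b m 0 ∧
    m.1 1 + m.2 1 = (b₁ b - b₃ b) ^ 2 * sumVelocity b m 1 ∧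
    m.1 2 + m.2 2 = (b₁ b - b₂ b) ^ 2 * sumVelocity b m 2 ∧
    m.1 0 - m.2 0 = (b₂ b + b₃ b) ^ 2 * diffVelocity b m 0 ∧
    m.1 1 - m.2 1 = (b₁ b + b₃ b) ^ 2 * diffVelocity b m 1 ∧
    m.1 2 - m.2 2 = (b₁ b + b₂ b) ^ 2 * diffVelocity b m 2 := by
  obtain ⟨h3, h32, h21, -⟩ := semiaxes_of_mem hb
  have h2 := h3.trans h32
  have h1 := h2.trans h21
  have n1 : b₂ b - b₃ b ≠ 0 := by linarith
  have n2 : b₁ b - b₃ b ≠ 0 := by linarith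
  have n3 : b₁ b - b₂ b ≠ 0 := by linarith
  simp only [sumVelocity, diffVelocity, cons_val_zero, cons_val_one, cons_val]
  refine ⟨?_, ?_, ?_, ?_, ?_, ?_⟩ <;> field_simp

/-- The two velocities are parallel to the respective momenta if and only if the three pair
relations hold. -/
lemma parallel_iff_pairRelation {b : V2} (hb : b ∈ configSpace) (m : V3 × V3) :
    (crossProduct m.1 (sumVelocity b m + diffVelocity b m) = 0 ∧
      crossProduct m.2 (sumVelocity b m - diffVelocity b m) = 0) ↔
    (PairRelation (b₁ b) (b₂ b) (b₃ b) (sumVelocity b m 0) (diffVelocity b m 0)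
        (sumVelocity b m 1) (diffVelocity b m 1) ∧
      PairRelation (b₁ b) (b₃ b) (b₂ b) (sumVelocity b m 0) (diffVelocity b m 0)
        (sumVelocity b m 2) (diffVelocity b m 2) ∧
      PairRelation (b₂ b) (b₃ b) (b₁ b) (sumVelocity b m 1) (diffVelocity b m 1)
        (sumVelocity b m 2) (diffVelocity b m 2)) := by
  obtain ⟨h3, h32, h21, -⟩ := semiaxes_of_mem hb
  have h2 := h3.trans h32
  have h1 := h2.trans h21
  obtain ⟨hS0, hS1, hS2, hD0, hD1, hD2⟩ := momenta_eq hb m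
  generalize sumVelocity b m = u at *
  generalize diffVelocity b m = v at *
  obtain ⟨ml, mr⟩ := m
  simp only at *
  have l0 : ml 0 = ((b₂ b - b₃ b) ^ 2 * u 0 + (b₂ b + b₃ b) ^ 2 * v 0) / 2 := by linarith
  have l1 : ml 1 = ((b₁ b - b₃ b) ^ 2 * u 1 + (b₁ b + b₃ b) ^ 2 * v 1) / 2 := by linarith
  have l2 : ml 2 = ((b₁ b - b₂ b) ^ 2 * u 2 + (b₁ b + b₂ b) ^ 2 * v 2) / 2 := by linarith
  have r0 : mr 0 = ((b₂ b - b₃ b) ^ 2 * u 0 - (b₂ b + b₃ b) ^ 2 * v 0) / 2 := by linarith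
  have r1 : mr 1 = ((b₁ b - b₃ b) ^ 2 * u 1 - (b₁ b + b₃ b) ^ 2 * v 1) / 2 := by linarith
  have r2 : mr 2 = ((b₁ b - b₂ b) ^ 2 * u 2 - (b₁ b + b₂ b) ^ 2 * v 2) / 2 := by linarith
  have key : ∀ x y z a a' c c' : ℝ, x - y ≠ 0 → x + y ≠ 0 →
      (PairRelation x y z a a' c c' ↔
      ((y - z) ^ 2 * a + (y + z) ^ 2 * a') / 2 * (c + c')
        - ((x - z) ^ 2 * c + (x + z) ^ 2 * c') / 2 * (a + a') = 0 ∧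
      ((y - z) ^ 2 * a - (y + z) ^ 2 * a') / 2 * (c - c')
        - ((x - z) ^ 2 * c - (x + z) ^ 2 * c') / 2 * (a - a') = 0) := by
    intro x y z a a' c c' hs ha
    constructor
    · rintro ⟨e1, e2⟩
      constructor
      · linear_combination (y - x) / 2 * e1 - (x + y) / 2 * e2
      · linear_combination (y - x) / 2 * e1 + (x + y) / 2 * e2
    · rintro ⟨e1, e2⟩
      constructor
      · refine mul_left_cancel₀ hs ?_
        linear_combination -e1 - e2
      · refine mul_left_cancel₀ ha ?_
        linear_combination e2 - e1
  rw [key _ _ _ _ _ _ _ (by linarith) (by linarith), key _ _ _ _ _ _ _ (by linarith) (by linarith),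
    key _ _ _ _ _ _ _ (by linarith) (by linarith)]
  rw [cross_apply, cross_apply]
  have vec : ∀ α β γ : ℝ, (![α, β, γ] = 0) ↔ (α = 0 ∧ β = 0 ∧ γ = 0) := by
    intro α β γ
    simp [funext_iff, Fin.forall_fin_succ]
  rw [vec, vec]
  simp only [Pi.add_apply, Pi.sub_apply, l0, l1, l2, r0, r1, r2]
  constructor
  · rintro ⟨⟨e1, e2, e3⟩, e4, e5, e6⟩
    refine ⟨⟨e3, e6⟩, ⟨?_, ?_⟩, ?_, ?_⟩
    · linear_combination -e2
    · linear_combination -e5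
    · linear_combination e1
    · linear_combination e4
  · rintro ⟨⟨e1, e2⟩, ⟨e3, e4⟩, e5, e6⟩
    refine ⟨⟨?_, ?_, e1⟩, ?_, ?_, e2⟩
    · linear_combination e5
    · linear_combination -e3
    · linear_combination e6
    · linear_combination -e4

/-- The equilibria are the points with `c = 0` whose velocities solve the algebraic equations. -/
lemma isEquilibrium_iff_isSteady (g : ℝ) {p : Phase} (hp : p.1 ∈ configSpace) :
    IsEquilibrium g p ↔ p.2.1 = 0 ∧
      IsSteady (C g 1 (b₁ p.1) (b₂ p.1) (b₃ p.1)) (C g 2 (b₁ p.1) (b₂ p.1) (b₃ p.1))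
        (b₁ p.1) (b₂ p.1) (b₃ p.1) (sumVelocity p.1 p.2.2) (diffVelocity p.1 p.2.2) := by
  obtain ⟨h3, h32, h21, hprod⟩ := semiaxes_of_mem hp
  have h2 := h3.trans h32
  have h1 := h2.trans h21
  obtain ⟨b, c, m⟩ := p
  simp only at *
  rw [isEquilibrium_iff_fderiv]
  have hω : ∀ ω : V3 × V3, fderiv ℝ (hamiltonian g) (b, c, m) (tangent (b, c, m) (0, 0, ω)) =
      -(1 / 2) * (ω.1 ⬝ᵥ crossProduct m.1 (sumVelocity b m + diffVelocity b m)
        + ω.2 ⬝ᵥ crossProduct m.2 (sumVelocity b m - diffVelocity b m)) := by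
    intro ω
    have := fderiv_hamiltonian_momenta g (p := (b, c, m)) hp
      (crossProduct m.1 ω.1, crossProduct m.2 ω.2)
    simp only [tangent]
    have triple : ∀ k w s : V3, crossProduct k w ⬝ᵥ s = -(w ⬝ᵥ crossProduct k s) := fun k w s => by
      rw [dotProduct_comm, triple_product_permutation, triple_product_permutation,
        ← cross_anticomm, dotProduct_neg]
    rw [this, triple, triple]
    ring
  constructor
  · intro h
    have hc : c = 0 := by
      have h0 := h (0, c, 0)
      have e : tangent (b, c, m) (0, c, 0) = (0, c, 0) := by simp [tangent]
      rw [e, fderiv_hamiltonian_stretch g (p := (b, c, m)) hp] at h0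
      have := stretch_form_eq_zero h1 h2 h3 hprod
        ((div_eq_zero_iff.1 h0).resolve_right (by positivity))
      ext i
      fin_cases i
      exacts [this.1, this.2]
    subst hc
    have hpar : crossProduct m.1 (sumVelocity b m + diffVelocity b m) = 0 ∧
        crossProduct m.2 (sumVelocity b m - diffVelocity b m) = 0 := by
      constructor
      · have h0 := hω (crossProduct m.1 (sumVelocity b m + diffVelocity b m), 0)
        rw [h, zero_dotProduct] at h0
        exact dotProduct_self_eq_zero.1 (by linarith)
      · have h0 := hω (0, crossProduct m.2 (sumVelocity b m - diffVelocity b m))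
        rw [h, zero_dotProduct] at h0
        exact dotProduct_self_eq_zero.1 (by linarith)
    obtain ⟨r1, r2, r3⟩ := (parallel_iff_pairRelation hp m).1 hpar
    have hb : ∀ v : V2, fderiv ℝ (hamiltonian g) (b, 0, m) (v, 0, 0) = 0 := fun v => by
      have e : tangent (b, 0, m) (v, 0, 0) = (v, 0, 0) := by simp [tangent]
      rw [← e, h]
    refine ⟨rfl, r1, r2, r3, ?_, ?_⟩
    · have h0 := hb ![b₁ b, 0]
      rw [fderiv_hamiltonian_semiaxes g hp] at h0
      simp only [cons_val_zero, cons_val_one, div_self h1.ne', zero_div] at h0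
      linarith
    · have h0 := hb ![0, b₂ b]
      rw [fderiv_hamiltonian_semiaxes g hp] at h0
      simp only [cons_val_zero, cons_val_one, div_self h2.ne', zero_div] at h0
      linarith
  · rintro ⟨rfl, r1, r2, r3, e1, e2⟩ ⟨v, w, ω⟩
    have hpar := (parallel_iff_pairRelation hp m).2 ⟨r1, r2, r3⟩
    have e : tangent (b, 0, m) (v, w, ω) = ((v, 0, 0) : Phase) + (0, w, 0)
        + tangent (b, 0, m) (0, 0, ω) := by simp [tangent]
    rw [e, map_add, map_add, hω, fderiv_hamiltonian_semiaxes g hp,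
      fderiv_hamiltonian_stretch g (p := (b, 0, m)) hp, hpar.1, hpar.2, e1, e2]
    simp

/-! ### The irrotational system inside the generic one -/

/-- The inclusion `(b, c, m) ↦ (b, c, (m, 0))`. -/
noncomputable def irrInclusion : IrrPhase →L[ℝ] Phase :=
  (ContinuousLinearMap.fst ℝ V2 (V2 × V3)).prod
    (((ContinuousLinearMap.fst ℝ V2 V3).comp (ContinuousLinearMap.snd ℝ V2 (V2 × V3))).prod
      (((ContinuousLinearMap.snd ℝ V2 V3).comp (ContinuousLinearMap.snd ℝ V2 (V2 × V3))).prod 0))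

lemma irrInclusion_apply (p : IrrPhase) : irrInclusion p = (p.1, p.2.1, (p.2.2, 0)) := rfl

lemma fderiv_irrHamiltonian (g : ℝ) {p : IrrPhase} (hp : p.1 ∈ configSpace) (Y : IrrPhase) :
    fderiv ℝ (irrHamiltonian g) p Y
      = fderiv ℝ (hamiltonian g) (irrInclusion p) (irrInclusion Y) := by
  have e : irrHamiltonian g = hamiltonian g ∘ irrInclusion := by
    ext q
    simp [irrHamiltonian, hamiltonian, irrInclusion_apply]
  rw [e, fderiv_comp p (differentiableAt_hamiltonian g hp) irrInclusion.differentiableAt,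
    irrInclusion.fderiv]
  rfl

lemma isIrrEquilibrium_iff_fderiv (g : ℝ) (p : IrrPhase) :
    IsIrrEquilibrium g p ↔ ∀ Y, fderiv ℝ (irrHamiltonian g) p (irrTangent p Y) = 0 := by
  constructor
  · rintro ⟨X, hX, h0⟩ Y
    rw [← hX Y]
    simp only [irrTangent, Prod.mk_eq_zero] at h0
    obtain ⟨hv, hw, hm⟩ := h0
    rw [irrSymplecticForm, hv, hw, triple_product_permutation, triple_product_permutation, hm]
    simp
  · intro h
    refine ⟨0, fun Y => ?_, by simp [irrTangent]⟩
    rw [h Y]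
    simp [irrSymplecticForm]

/-- The zero momentum has no tangent directions, so the equilibria of the six-dimensional systems
are the solutions of the generic equilibrium equations with one vanishing momentum. -/
lemma isIrrEquilibrium_iff (g : ℝ) {p : IrrPhase} (hp : p.1 ∈ configSpace) :
    IsIrrEquilibrium g p ↔ IsEquilibrium g (p.1, p.2.1, (p.2.2, 0)) := by
  rw [isIrrEquilibrium_iff_fderiv, isEquilibrium_iff_fderiv]
  simp only [fderiv_irrHamiltonian g hp]
  constructor
  · intro h Y
    have := h (Y.1, Y.2.1, Y.2.2.1)
    simpa [irrInclusion_apply, irrTangent, tangent] using this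
  · intro h Y
    have := h (Y.1, Y.2.1, (Y.2.2, 0))
    simpa [irrInclusion_apply, irrTangent, tangent] using this

/-! ### Ellipsoids rotating about one axis -/

lemma balance_swap_right {P Q x y z a a' c c' d d' : ℝ} :
    Balance P Q x z y a a' d d' c c' ↔ Balance P Q x y z a a' c c' d d' := by
  unfold Balance axisForce
  constructor <;> rintro ⟨h1, h2⟩ <;> constructor <;> linarith

lemma balance_swap_left {P Q x y z a a' c c' d d' : ℝ} :
    Balance P Q y x z c c' a a' d d' ↔ Balance P Q x y z a a' c c' d d' := by
  unfold Balance axisForce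
  constructor <;> rintro ⟨h1, h2⟩ <;> constructor <;> linarith

/-- `G^S_±` in terms of the differences of the gravitational forces. -/
lemma GS_eq (g ε : ℝ) {x y z : ℝ} (hx : x ≠ 0) (hz : z ≠ 0) (hε : ε = 1 ∨ ε = -1) :
    GS g ε x y z = (x - ε * z) ^ 3 / (x * z) *
      (z * ((x ^ 2 - y ^ 2) * (C g 2 x y z + z ^ 2 * C g 1 x y z))
        - ε * (x * ((z ^ 2 - y ^ 2) * (C g 2 x y z + x ^ 2 * C g 1 x y z)))) := by
  unfold GS
  rcases hε with rfl | rfl <;> field_simp <;> ring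

/-- Rotation about the axis of length `y`: the balance of forces determines both momenta. -/
lemma balance_single_iff (g : ℝ) {x y z a a' : ℝ} (hx : 0 < x) (hz : 0 < z) (hxz : x ≠ z) :
    Balance (C g 1 x y z) (C g 2 x y z) x y z 0 0 a a' 0 0 ↔
      ((x - z) ^ 2 * a) ^ 2 = GS g 1 x y z ∧ ((x + z) ^ 2 * a') ^ 2 = GS g (-1) x y z := by
  rw [GS_eq g 1 hx.ne' hz.ne' (Or.inl rfl), GS_eq g (-1) hx.ne' hz.ne' (Or.inr rfl)]
  unfold Balance axisForce
  generalize C g 1 x y z = P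
  generalize C g 2 x y z = Q
  have hs : x - z ≠ 0 := sub_ne_zero.2 hxz
  have ha : x + z ≠ 0 := by positivity
  have n1 : (x - z) ^ 3 / (x * z) ≠ 0 := div_ne_zero (pow_ne_zero 3 hs) (by positivity)
  have n2 : (x + z) ^ 3 / (x * z) ≠ 0 := div_ne_zero (pow_ne_zero 3 ha) (by positivity)
  constructor
  · rintro ⟨h1, h2⟩
    have e1 : z * ((x ^ 2 - y ^ 2) * (Q + z ^ 2 * P)) - x * ((z ^ 2 - y ^ 2) * (Q + x ^ 2 * P))
        = x * z * (x - z) * a ^ 2 := by linear_combination (-z) * h1 + (z - x) * h2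
    have e2 : z * ((x ^ 2 - y ^ 2) * (Q + z ^ 2 * P)) + x * ((z ^ 2 - y ^ 2) * (Q + x ^ 2 * P))
        = x * z * (x + z) * a' ^ 2 := by linear_combination (-z) * h1 + (z + x) * h2
    constructor
    · rw [one_mul, one_mul, e1]; field_simp
    · rw [neg_one_mul, neg_one_mul, sub_neg_eq_add, sub_neg_eq_add, e2]; field_simp
  · rintro ⟨h1, h2⟩
    have e1 : z * ((x ^ 2 - y ^ 2) * (Q + z ^ 2 * P)) - x * ((z ^ 2 - y ^ 2) * (Q + x ^ 2 * P))
        = x * z * (x - z) * a ^ 2 := by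
      refine mul_left_cancel₀ n1 ?_
      rw [one_mul, one_mul] at h1
      rw [← h1]; field_simp
    have e2 : z * ((x ^ 2 - y ^ 2) * (Q + z ^ 2 * P)) + x * ((z ^ 2 - y ^ 2) * (Q + x ^ 2 * P))
        = x * z * (x + z) * a' ^ 2 := by
      refine mul_left_cancel₀ n2 ?_
      rw [neg_one_mul, neg_one_mul, sub_neg_eq_add, sub_neg_eq_add] at h2
      rw [← h2]; field_simp
    constructor
    · refine mul_left_cancel₀ (mul_pos hx hz).ne' ?_
      linear_combination (-(x - z) / 2) * e2 - (x + z) / 2 * e1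
    · refine mul_left_cancel₀ (mul_pos hx hz).ne' ?_
      linear_combination z / 2 * e2 - z / 2 * e1

/-- No balance is possible for a rotation about the longest axis. -/
lemma not_balance_longest {P Q x y z a a' : ℝ} (hP : 0 < P) (hQ : 0 < Q) (hz : 0 < z)
    (hzy : z < y) (hyx : y < x) : ¬ Balance P Q x y z a a' 0 0 0 0 := by
  rintro ⟨h1, h2⟩
  unfold axisForce at h1 h2
  have hy := hz.trans hzy
  have hF : 0 ≤ y / 2 * ((y - z) * a ^ 2 + (y + z) * a' ^ 2) := by
    have : 0 ≤ y - z := by linarith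
    positivity
  have : 0 < (x ^ 2 - y ^ 2) * (Q + z ^ 2 * P) := by
    have : 0 < x ^ 2 - y ^ 2 := by nlinarith
    positivity
  linarith

section
variable {g x y z : ℝ}

lemma GS_one_pos (hg : 0 < g) (hz : 0 < z) (hzy : z < y) (hyx : y < x) : 0 < GS g 1 x y z := by
  have hy := hz.trans hzy
  have hx := hy.trans hyx
  have hP := C_pos hg hx hy hz (n := 1) (by norm_num)
  have hQ := C_pos hg hx hy hz (n := 2) (by norm_num)
  rw [GS_eq g 1 hx.ne' hz.ne' (Or.inl rfl)]
  have h1 : 0 < x - 1 * z := by linarith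
  have h2 : 0 < x ^ 2 - y ^ 2 := by nlinarith
  have h3 : 0 < y ^ 2 - z ^ 2 := by nlinarith
  have e : z ^ 2 - y ^ 2 = -(y ^ 2 - z ^ 2) := by ring
  rw [e, neg_mul, mul_neg, mul_neg, sub_neg_eq_add]
  positivity

/-- For a rotation about the shortest axis the difference momentum exceeds the sum momentum. -/
lemma GS_one_lt_GS_neg_one (hg : 0 < g) (hy : 0 < y) (hyz : y < z) (hzx : z < x)
    (h : 0 ≤ GS g 1 x y z) : GS g 1 x y z < GS g (-1) x y z := by
  have hz := hy.trans hyz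
  have hx := hz.trans hzx
  have hP := C_pos hg hx hy hz (n := 1) (by norm_num)
  have hQ := C_pos hg hx hy hz (n := 2) (by norm_num)
  rw [GS_eq g 1 hx.ne' hz.ne' (Or.inl rfl)] at h ⊢
  rw [GS_eq g (-1) hx.ne' hz.ne' (Or.inr rfl)]
  have h1 : 0 < x - 1 * z := by linarith
  have hA : 0 < z * ((x ^ 2 - y ^ 2) * (C g 2 x y z + z ^ 2 * C g 1 x y z)) := by
    have : 0 < x ^ 2 - y ^ 2 := by nlinarith
    positivity
  have hB : 0 < x * ((z ^ 2 - y ^ 2) * (C g 2 x y z + x ^ 2 * C g 1 x y z)) := by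
    have : 0 < z ^ 2 - y ^ 2 := by nlinarith
    positivity
  generalize z * ((x ^ 2 - y ^ 2) * (C g 2 x y z + z ^ 2 * C g 1 x y z)) = A at *
  generalize x * ((z ^ 2 - y ^ 2) * (C g 2 x y z + x ^ 2 * C g 1 x y z)) = B at *
  have h0 : 0 ≤ A - 1 * B := nonneg_of_mul_nonneg_right h (by positivity)
  refine mul_lt_mul' ?_ (by linarith) h0 ?_
  · gcongr
    linarith
  · have : 0 < x - -1 * z := by linarith
    positivity

end

/-! ### Ellipsoids with momenta in a principal plane -/

/-- The relations in a principal plane fix the ratios of the squared velocities. -/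
lemma PairRelation.ratio {x y z a a' c c' : ℝ} (h : PairRelation x y z a a' c c')
    (hc : c ≠ 0 ∨ c' ≠ 0) :
    a ^ 2 * (x ^ 2 - (y - 2 * z) ^ 2) = a' ^ 2 * (x ^ 2 - (y + 2 * z) ^ 2) := by
  obtain ⟨h1, h2⟩ := h
  rcases hc with hc | hc
  · refine mul_left_cancel₀ hc ?_
    linear_combination (x - y + 2 * z) * a * h1 - (x + y + 2 * z) * a' * h2
  · refine mul_left_cancel₀ hc ?_
    linear_combination (x + y - 2 * z) * a * h2 - (x - y - 2 * z) * a' * h1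

lemma PairRelation.symm {x y z a a' c c' : ℝ} (h : PairRelation x y z a a' c c') :
    PairRelation y x z c c' a a' := by
  obtain ⟨h1, h2⟩ := h
  constructor
  · linear_combination h1
  · linear_combination -h2

/-- Momenta with nonzero components along all three axes are impossible. -/
lemma PairRelation.false_of_three {x y z a a' c c' d d' : ℝ} (h : PairRelation x y z a a' c c')
    (h' : PairRelation x z y a a' d d') (ha : a ≠ 0 ∨ a' ≠ 0) (hc : c ≠ 0 ∨ c' ≠ 0)
    (hd : d ≠ 0 ∨ d' ≠ 0) (hy : 0 < y) (hz : 0 < z) (hzy : z < y) : False := by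
  have r1 := h.ratio hc
  have r2 := h'.ratio hd
  have hdet : 0 < y * z * (y ^ 2 - z ^ 2) := by
    have : 0 < y ^ 2 - z ^ 2 := by nlinarith
    positivity
  rcases ha with ha | ha
  · have : a ^ 2 * (y * z * (y ^ 2 - z ^ 2)) = 0 := by
      linear_combination (x ^ 2 - (y + 2 * z) ^ 2) / 24 * r2 - (x ^ 2 - (z + 2 * y) ^ 2) / 24 * r1
    exact (mul_ne_zero (pow_ne_zero 2 ha) hdet.ne') this
  · have : a' ^ 2 * (y * z * (y ^ 2 - z ^ 2)) = 0 := by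
      linear_combination (x ^ 2 - (y - 2 * z) ^ 2) / 24 * r2 - (x ^ 2 - (z - 2 * y) ^ 2) / 24 * r1
    exact (mul_ne_zero (pow_ne_zero 2 ha) hdet.ne') this

/-- The common factor of the squared velocities along the axis of length `x`: they are
`planarScale g x y z * (x² - (y ± 2z)²)`. -/
noncomputable def planarScale (g x y z : ℝ) : ℝ :=
  (x ^ 2 - z ^ 2) / (x ^ 2 - y ^ 2) * (G g x y z / D x y z)

lemma GR_eq (g ε x y z : ℝ) : GR g ε x y z =
    (y - ε * z) ^ 4 * (planarScale g x y z * (x ^ 2 - (y + ε * (2 * z)) ^ 2)) := by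
  unfold GR planarScale; ring

lemma D_comm (x y z : ℝ) : D y x z = D x y z := by unfold D; ring

/-- The squared velocities in a principal plane are the solution of a linear system with
determinant a multiple of `D`; the system is inconsistent where `D` vanishes. -/
lemma exists_planarScale {g x y z a a' c c' : ℝ} (hg : 0 < g) (hx : 0 < x) (hy : 0 < y)
    (hz : 0 < z) (hxy : x ≠ y) (hxz : x ≠ z) (hr : PairRelation x y z a a' c c')
    (ha : a ≠ 0 ∨ a' ≠ 0) (hc : c ≠ 0 ∨ c' ≠ 0)
    (hB : Balance (C g 1 x y z) (C g 2 x y z) x y z a a' c c' 0 0) :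
    D x y z ≠ 0 ∧
    a ^ 2 = planarScale g x y z * (x ^ 2 - (y + 2 * z) ^ 2) ∧
    a' ^ 2 = planarScale g x y z * (x ^ 2 - (y - 2 * z) ^ 2) ∧
    c ^ 2 = planarScale g y x z * (y ^ 2 - (x + 2 * z) ^ 2) ∧
    c' ^ 2 = planarScale g y x z * (y ^ 2 - (x - 2 * z) ^ 2) := by
  have r1 := hr.ratio hc
  have r2 := hr.symm.ratio ha
  have hP := C_pos hg hx hy hz (n := 1) (by norm_num)
  have hQ := C_pos hg hx hy hz (n := 2) (by norm_num)
  have hxy2 : x ^ 2 - y ^ 2 ≠ 0 := by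
    rw [sq_sub_sq]; exact mul_ne_zero (by positivity) (sub_ne_zero.2 hxy)
  have hyx2 : y ^ 2 - x ^ 2 ≠ 0 := by rw [← neg_sub]; exact neg_ne_zero.2 hxy2
  have hxz2 : x ^ 2 - z ^ 2 ≠ 0 := by
    rw [sq_sub_sq]; exact mul_ne_zero (by positivity) (sub_ne_zero.2 hxz)
  -- the two radicands along the first axis differ by `8yz`, which determines the factor
  obtain ⟨t, ht⟩ : ∃ t, t = (a' ^ 2 - a ^ 2) / (8 * y * z) := ⟨_, rfl⟩
  obtain ⟨s, hs⟩ : ∃ s, s = (c' ^ 2 - c ^ 2) / (8 * x * z) := ⟨_, rfl⟩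
  have a1 : a ^ 2 = t * (x ^ 2 - (y + 2 * z) ^ 2) := by
    rw [ht]; field_simp; linear_combination r1
  have a2 : a' ^ 2 = t * (x ^ 2 - (y - 2 * z) ^ 2) := by
    rw [ht]; field_simp; linear_combination r1
  have c1 : c ^ 2 = s * (y ^ 2 - (x + 2 * z) ^ 2) := by
    rw [hs]; field_simp; linear_combination r2
  have c2 : c' ^ 2 = s * (y ^ 2 - (x - 2 * z) ^ 2) := by
    rw [hs]; field_simp; linear_combination r2
  obtain ⟨b1, b2⟩ := hB
  unfold axisForce at b1 b2
  rw [a1, a2, c1, c2] at b1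
  rw [a1, a2, c1, c2] at b2
  have ht : t * (D x y z * (x ^ 2 - y ^ 2)) = (x ^ 2 - z ^ 2) * G g x y z := by
    refine mul_left_cancel₀ hxy2 ?_
    unfold D G
    linear_combination (x ^ 2 * (x ^ 2 - y ^ 2) + z ^ 2 * (y ^ 2 + 3 * x ^ 2 - 4 * z ^ 2)) * b2
      - z ^ 2 * (y ^ 2 + 3 * x ^ 2 - 4 * z ^ 2) * b1
  have hs : s * (D x y z * (y ^ 2 - x ^ 2)) = (y ^ 2 - z ^ 2) * G g y x z := by
    refine mul_left_cancel₀ hyx2 ?_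
    unfold D G
    rw [C_swap_left g 1 x, C_swap_left g 2 x]
    linear_combination (y ^ 2 * (y ^ 2 - x ^ 2) + z ^ 2 * (x ^ 2 + 3 * y ^ 2 - 4 * z ^ 2)) * b1
      - z ^ 2 * (x ^ 2 + 3 * y ^ 2 - 4 * z ^ 2) * b2
  -- where `D = 0`, the equations force `G = 0`, hence `y² = 4z²`, which contradicts `D = 0`
  have hD : D x y z ≠ 0 := by
    intro h0
    rw [h0, zero_mul, mul_zero, eq_comm] at ht
    have hG := (mul_eq_zero.1 ht).resolve_left hxz2
    unfold G at hG
    unfold D at h0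
    have h4 : (y ^ 2 - 4 * z ^ 2) * (2 * z ^ 2 * C g 1 x y z + C g 2 x y z) = 0 := by
      linear_combination hG - C g 1 x y z * h0
    have h4 := (mul_eq_zero.1 h4).resolve_right (by positivity)
    have : 3 * x ^ 2 * z ^ 2 = 0 := by linear_combination h0 - (x ^ 2 - z ^ 2) * h4
    exact (by positivity : 3 * x ^ 2 * z ^ 2 ≠ 0) this
  have et : t = planarScale g x y z := by
    unfold planarScale
    field_simp
    linear_combination ht
  have es : s = planarScale g y x z := by
    unfold planarScale
    rw [D_comm]
    field_simp
    linear_combination hs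
  rw [← et, ← es]
  exact ⟨hD, a1, a2, c1, c2⟩

/-- Conversely, where `D` does not vanish, these squared velocities balance the forces. -/
lemma balance_of_planarScale {g x y z a a' c c' : ℝ} (hxy : x ^ 2 - y ^ 2 ≠ 0) (hD : D x y z ≠ 0)
    (a1 : a ^ 2 = planarScale g x y z * (x ^ 2 - (y + 2 * z) ^ 2))
    (a2 : a' ^ 2 = planarScale g x y z * (x ^ 2 - (y - 2 * z) ^ 2))
    (c1 : c ^ 2 = planarScale g y x z * (y ^ 2 - (x + 2 * z) ^ 2))
    (c2 : c' ^ 2 = planarScale g y x z * (y ^ 2 - (x - 2 * z) ^ 2)) :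
    Balance (C g 1 x y z) (C g 2 x y z) x y z a a' c c' 0 0 := by
  have hyx : y ^ 2 - x ^ 2 ≠ 0 := by rw [← neg_sub]; exact neg_ne_zero.2 hxy
  have ht : planarScale g x y z * (D x y z * (x ^ 2 - y ^ 2)) = (x ^ 2 - z ^ 2) * G g x y z := by
    unfold planarScale; field_simp
  have hs : planarScale g y x z * (D x y z * (x ^ 2 - y ^ 2)) = -((y ^ 2 - z ^ 2) * G g y x z) := by
    unfold planarScale; rw [D_comm]; field_simp; ring
  generalize planarScale g x y z = t at *
  generalize planarScale g y x z = s at *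
  have hne := mul_ne_zero hD hxy
  unfold Balance axisForce
  rw [a1, a2, c1, c2]
  unfold G at ht hs
  rw [C_swap_left g 1 x, C_swap_left g 2 x] at hs
  constructor
  · refine mul_left_cancel₀ hne ?_
    unfold D at *
    linear_combination (-z ^ 2 * (x ^ 2 + 3 * y ^ 2 - 4 * z ^ 2)) * ht
      - (x ^ 2 * (x ^ 2 - y ^ 2) + z ^ 2 * (y ^ 2 + 3 * x ^ 2 - 4 * z ^ 2)) * hs
  · refine mul_left_cancel₀ hne ?_
    unfold D at *
    linear_combination (-z ^ 2 * (y ^ 2 + 3 * x ^ 2 - 4 * z ^ 2)) * hs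
      + (y ^ 2 * (x ^ 2 - y ^ 2) - z ^ 2 * (x ^ 2 + 3 * y ^ 2 - 4 * z ^ 2)) * ht

lemma eq_neg_of_sq_eq_sq_of_mul_nonpos {u v : ℝ} (h : u ^ 2 = v ^ 2) (huv : u * v ≤ 0) :
    u + v = 0 := by
  rcases sq_eq_sq_iff_eq_or_eq_neg.1 h with rfl | rfl
  · have : u = 0 := mul_self_eq_zero.1 (le_antisymm huv (mul_self_nonneg u))
    simp [this]
  · simp

/-- The two sides of either relation have equal squares, so only their signs matter. -/
lemma pairRelation_of_planarScale {t s x y z a a' c c' : ℝ} (hx : 0 < x) (hy : 0 < y) (hz : 0 < z)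
    (a1 : a ^ 2 = t * (x ^ 2 - (y + 2 * z) ^ 2)) (a2 : a' ^ 2 = t * (x ^ 2 - (y - 2 * z) ^ 2))
    (c1 : c ^ 2 = s * (y ^ 2 - (x + 2 * z) ^ 2)) (c2 : c' ^ 2 = s * (y ^ 2 - (x - 2 * z) ^ 2))
    (h1 : (x + y - 2 * z) * (a * c * (a' * c')) ≤ 0)
    (h2 : ((x - y) ^ 2 - 4 * z ^ 2) * (a * c * (a' * c')) ≤ 0) :
    PairRelation x y z a a' c c' := by
  constructor
  · refine eq_neg_of_sq_eq_sq_of_mul_nonpos ?_ ?_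
    · rw [mul_pow, mul_pow, mul_pow, mul_pow, a1, a2, c1, c2]; ring
    · have : 0 < x + y + 2 * z := by positivity
      nlinarith
  · refine eq_neg_of_sq_eq_sq_of_mul_nonpos ?_ ?_
    · rw [mul_pow, mul_pow, mul_pow, mul_pow, a1, a2, c1, c2]; ring
    · linarith

/-! ### The existence regions in a principal plane -/

/-- The existence condition for momenta in the plane of the axes of lengths `y < x`, with third
axis `z`: with `κ = 1` it describes `x + y ≤ 2z`, and with `κ = -1` it describes `y + 2z ≤ x`. The
conditions on the scales make the squared velocities nonnegative. -/
structure IsPlanar (g κ x y z : ℝ) : Prop where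
  D_ne_zero : D x y z ≠ 0
  scale_long : κ * planarScale g x y z < 0
  scale_short : planarScale g y x z < 0
  sum_le : κ * (x + y - 2 * z) ≤ 0
  diff_le : κ * (x - y - 2 * z) ≤ 0

section
variable {g κ x y z : ℝ}

lemma sign_mul_self (hκ : κ = 1 ∨ κ = -1) : κ * κ = 1 := by rcases hκ with rfl | rfl <;> norm_num

namespace IsPlanar

lemma radicand_long_nonneg (h : IsPlanar g κ x y z) (hκ : κ = 1 ∨ κ = -1) (hy : 0 < y) (hyx : y < x)
    (hz : 0 < z) : 0 ≤ planarScale g x y z * (x ^ 2 - (y + 2 * z) ^ 2) ∧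
      0 ≤ planarScale g x y z * (x ^ 2 - (y - 2 * z) ^ 2) := by
  have hs := sign_mul_self hκ
  have h1 := mul_nonneg (mul_nonneg_of_nonpos_of_nonpos h.scale_long.le h.diff_le)
    (by linarith : 0 ≤ x + y + 2 * z)
  have h2 := mul_nonneg (mul_nonneg_of_nonpos_of_nonpos h.scale_long.le h.sum_le)
    (by linarith : 0 ≤ x - y + 2 * z)
  constructor
  · refine h1.trans_eq ?_
    linear_combination (planarScale g x y z * (x ^ 2 - (y + 2 * z) ^ 2)) * hs
  · refine h2.trans_eq ?_
    linear_combination (planarScale g x y z * (x ^ 2 - (y - 2 * z) ^ 2)) * hs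

lemma radicand_short_pos (h : IsPlanar g κ x y z) (hy : 0 < y) (hyx : y < x) (hz : 0 < z) :
    0 < planarScale g y x z * (y ^ 2 - (x + 2 * z) ^ 2) :=
  mul_pos_of_neg_of_neg h.scale_short (by nlinarith)

lemma radicand_short_nonneg (h : IsPlanar g κ x y z) (hκ : κ = 1 ∨ κ = -1) :
    0 ≤ planarScale g y x z * (y ^ 2 - (x - 2 * z) ^ 2) := by
  have := mul_nonneg_of_nonpos_of_nonpos h.sum_le h.diff_le
  refine mul_nonneg_of_nonpos_of_nonpos h.scale_short.le ?_
  have e : y ^ 2 - (x - 2 * z) ^ 2 = -(κ * (x + y - 2 * z) * (κ * (x - y - 2 * z))) := by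
    linear_combination (x + y - 2 * z) * (x - y - 2 * z) * sign_mul_self hκ
  linarith

lemma GR_nonneg (h : IsPlanar g κ x y z) (hκ : κ = 1 ∨ κ = -1) (hy : 0 < y) (hyx : y < x)
    (hz : 0 < z) : 0 ≤ GR g 1 x y z ∧ 0 ≤ GR g (-1) x y z ∧ 0 ≤ GR g 1 y x z ∧
      0 ≤ GR g (-1) y x z := by
  obtain ⟨r1, r2⟩ := h.radicand_long_nonneg hκ hy hyx hz
  have r3 := h.radicand_short_pos hy hyx hz
  have r4 := h.radicand_short_nonneg hκ
  simp only [GR_eq, one_mul, neg_one_mul, ← sub_eq_add_neg, sub_neg_eq_add]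
  refine ⟨?_, ?_, ?_, ?_⟩ <;> positivity

lemma nrIsReal (h : IsPlanar g κ x y z) (hκ : κ = 1 ∨ κ = -1) (hy : 0 < y) (hyx : y < x)
    (hz : 0 < z) : NRIsReal g x y z ∧ NRIsReal g y x z := by
  obtain ⟨r1, r2, r3, r4⟩ := h.GR_nonneg hκ hy hyx hz
  have : 0 < x ^ 2 - y ^ 2 := by nlinarith
  exact ⟨⟨this.ne', h.D_ne_zero, r1, r2⟩, by linarith, D_comm x y z ▸ h.D_ne_zero, r3, r4⟩

lemma GR_one_short_pos (h : IsPlanar g κ x y z) (hy : 0 < y) (hyx : y < x) (hz : 0 < z)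
    (hxz : x ≠ z) : 0 < GR g 1 y x z := by
  have r := h.radicand_short_pos hy hyx hz
  have : x - z ≠ 0 := sub_ne_zero.2 hxz
  rw [GR_eq, one_mul, one_mul]
  positivity

lemma GR_one_long_pos (h : IsPlanar g 1 x y z) (hy : 0 < y) (hyx : y < x) (hz : 0 < z)
    (hyz : y ≠ z) : 0 < GR g 1 x y z := by
  have h1 := h.scale_long
  have h2 := h.sum_le
  have : y - z ≠ 0 := sub_ne_zero.2 hyz
  have r : 0 < planarScale g x y z * (x ^ 2 - (y + 2 * z) ^ 2) :=
    mul_pos_of_neg_of_neg (by linarith) (by nlinarith)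
  rw [GR_eq, one_mul, one_mul]
  positivity

lemma GR_neg_one_long_pos (h : IsPlanar g (-1) x y z) (hy : 0 < y) (hyx : y < x) (hz : 0 < z) :
    0 < GR g (-1) x y z := by
  have h1 := h.scale_long
  have h2 := h.diff_le
  have r : 0 < planarScale g x y z * (x ^ 2 - (y - 2 * z) ^ 2) :=
    mul_pos (by linarith) (by nlinarith)
  rw [GR_eq, neg_one_mul, neg_one_mul, sub_neg_eq_add, ← sub_eq_add_neg]
  positivity

end IsPlanar

lemma sq_eq_GR_iff {a : ℝ} (ε : ℝ) (hyz : y - ε * z ≠ 0) :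
    ((y - ε * z) ^ 2 * a) ^ 2 = GR g ε x y z ↔
      a ^ 2 = planarScale g x y z * (x ^ 2 - (y + ε * (2 * z)) ^ 2) := by
  rw [GR_eq, mul_pow, ← pow_mul]
  exact mul_right_inj' (pow_ne_zero 4 hyz)

lemma exists_sign (p : ℝ) : ∃ σ : ℝ, (σ = 1 ∨ σ = -1) ∧ p = σ * |p| := by
  rcases abs_choice p with h | h
  · exact ⟨1, Or.inl rfl, by rw [h, one_mul]⟩
  · exact ⟨-1, Or.inr rfl, by rw [h]; ring⟩

lemma sign_mul {σ τ : ℝ} (hσ : σ = 1 ∨ σ = -1) (hτ : τ = 1 ∨ τ = -1) :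
    σ * τ = 1 ∨ σ * τ = -1 := by
  rcases hσ with rfl | rfl <;> rcases hτ with rfl | rfl <;> norm_num

/-- Four numbers whose product has the sign `κ` carry signs of the form `σ, σδ, σ', σ'κδ`. If one
of the numbers vanishes, its sign is free. -/
lemma exists_signs {p q r s : ℝ} (hκ : κ = 1 ∨ κ = -1) (h : 0 ≤ κ * (p * r * (q * s))) :
    ∃ σ σ' δ : ℝ, (σ = 1 ∨ σ = -1) ∧ (σ' = 1 ∨ σ' = -1) ∧ (δ = 1 ∨ δ = -1) ∧
      p = σ * |p| ∧ q = σ * δ * |q| ∧ r = σ' * |r| ∧ s = σ' * (κ * δ) * |s| := by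
  obtain ⟨σp, hp, ep⟩ := exists_sign p
  obtain ⟨σq, hq, eq⟩ := exists_sign q
  obtain ⟨σr, hr, er⟩ := exists_sign r
  obtain ⟨σs, hs, es⟩ := exists_sign s
  have main : ∀ σp σq σr σs : ℝ, (σp = 1 ∨ σp = -1) → (σq = 1 ∨ σq = -1) → (σr = 1 ∨ σr = -1) →
      (σs = 1 ∨ σs = -1) → p = σp * |p| → q = σq * |q| → r = σr * |r| → s = σs * |s| →
      κ * (σp * σr * (σq * σs)) = 1 →
      ∃ σ σ' δ : ℝ, (σ = 1 ∨ σ = -1) ∧ (σ' = 1 ∨ σ' = -1) ∧ (δ = 1 ∨ δ = -1) ∧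
      p = σ * |p| ∧ q = σ * δ * |q| ∧ r = σ' * |r| ∧ s = σ' * (κ * δ) * |s| := by
    intro σp σq σr σs hp hq hr hs ep eq er es h1
    refine ⟨σp, σr, σp * σq, hp, hr, sign_mul hp hq, ep, ?_, er, ?_⟩
    · rw [← mul_assoc, sign_mul_self hp, one_mul]; exact eq
    · have e : σr * (κ * (σp * σq)) = σs := by
        linear_combination (-(σr * (κ * (σp * σq)))) * sign_mul_self hs + σs * h1
      rw [e]; exact es
  -- if the product of the signs is wrong, the product of the numbers is zero
  have hprod := sign_mul hκ (sign_mul (sign_mul hp hr) (sign_mul hq hs))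
  rcases hprod with h1 | h1
  · exact main σp σq σr σs hp hq hr hs ep eq er es h1
  have h0 : |p| * |r| * (|q| * |s|) = 0 := by
    refine le_antisymm ?_ (by positivity)
    have : κ * (p * r * (q * s)) = κ * (σp * σr * (σq * σs)) * (|p| * |r| * (|q| * |s|)) := by
      conv_lhs => rw [ep, eq, er, es]
      ring
    rw [this, h1] at h
    linarith
  have neg_sign : ∀ {σ : ℝ}, (σ = 1 ∨ σ = -1) → (-σ = 1 ∨ -σ = -1) := by
    rintro σ (rfl | rfl) <;> norm_num
  simp only [mul_eq_zero, abs_eq_zero] at h0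
  rcases h0 with (h0 | h0) | (h0 | h0)
  · exact main (-σp) σq σr σs (neg_sign hp) hq hr hs (by simp [h0]) eq er es (by linarith)
  · exact main σp σq (-σr) σs hp hq (neg_sign hr) hs ep eq (by simp [h0]) es (by linarith)
  · exact main σp (-σq) σr σs hp (neg_sign hq) hr hs ep (by simp [h0]) er es (by linarith)
  · exact main σp σq σr (-σs) hp hq hr (neg_sign hs) ep eq er (by simp [h0]) (by linarith)

variable {a a' c c' : ℝ}

/-- Steady motions with momenta in a principal plane have the stated form. -/
lemma exists_isPlanar (hg : 0 < g) (hy : 0 < y) (hyx : y < x) (hz : 0 < z) (hxz : x ≠ z)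
    (hyz : y ≠ z) (hr : PairRelation x y z a a' c c') (ha : a ≠ 0 ∨ a' ≠ 0) (hc : c ≠ 0 ∨ c' ≠ 0)
    (hB : Balance (C g 1 x y z) (C g 2 x y z) x y z a a' c c' 0 0) :
    ∃ κ : ℝ, (κ = 1 ∨ κ = -1) ∧ IsPlanar g κ x y z ∧
      ∃ σ σ' δ : ℝ, (σ = 1 ∨ σ = -1) ∧ (σ' = 1 ∨ σ' = -1) ∧ (δ = 1 ∨ δ = -1) ∧
        (y - z) ^ 2 * a = σ * √(GR g 1 x y z) ∧ (y + z) ^ 2 * a' = σ * δ * √(GR g (-1) x y z) ∧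
        (x - z) ^ 2 * c = σ' * √(GR g 1 y x z) ∧
        (x + z) ^ 2 * c' = σ' * (κ * δ) * √(GR g (-1) y x z) := by
  have hx := hy.trans hyx
  obtain ⟨hD, a1, a2, c1, c2⟩ := exists_planarScale hg hx hy hz hyx.ne' hxz hr ha hc hB
  have ht0 : planarScale g x y z ≠ 0 := by
    intro h0
    rw [h0, zero_mul] at a1 a2
    rcases ha with ha | ha
    · exact ha (pow_eq_zero_iff two_ne_zero |>.1 a1)
    · exact ha (pow_eq_zero_iff two_ne_zero |>.1 a2)
  have hs0 : planarScale g y x z ≠ 0 := by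
    intro h0
    rw [h0, zero_mul] at c1 c2
    rcases hc with hc | hc
    · exact hc (pow_eq_zero_iff two_ne_zero |>.1 c1)
    · exact hc (pow_eq_zero_iff two_ne_zero |>.1 c2)
  have hs : planarScale g y x z < 0 := by
    refine lt_of_le_of_ne ?_ hs0
    by_contra! hpos
    have : y ^ 2 - (x + 2 * z) ^ 2 < 0 := by nlinarith
    nlinarith [sq_nonneg c, mul_pos hpos (neg_pos.2 this)]
  have hd : 0 ≤ planarScale g x y z * (x - y - 2 * z) := by
    refine nonneg_of_mul_nonneg_left (b := x + y + 2 * z) ?_ (by positivity)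
    have := sq_nonneg a
    rw [a1] at this
    linarith
  have hu : 0 ≤ planarScale g x y z * (x + y - 2 * z) := by
    refine nonneg_of_mul_nonneg_left (b := x - y + 2 * z) ?_ (by linarith)
    have := sq_nonneg a'
    rw [a2] at this
    linarith
  obtain ⟨κ, hκ, hκt⟩ : ∃ κ : ℝ, (κ = 1 ∨ κ = -1) ∧ κ * planarScale g x y z < 0 := by
    rcases lt_or_gt_of_ne ht0 with h | h
    · exact ⟨1, Or.inl rfl, by linarith⟩
    · exact ⟨-1, Or.inr rfl, by linarith⟩
  have hflip : ∀ w, 0 ≤ planarScale g x y z * w → κ * w ≤ 0 := by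
    intro w hw
    by_contra! hpos
    have h1 := mul_neg_of_neg_of_pos hκt hpos
    have : κ * planarScale g x y z * (κ * w) = planarScale g x y z * w := by
      linear_combination planarScale g x y z * w * sign_mul_self hκ
    linarith
  have hP : IsPlanar g κ x y z := ⟨hD, hκt, hs, hflip _ hu, hflip _ hd⟩
  have hsign : 0 ≤ κ * (a * c * (a' * c')) := by
    have e1 : (x + y - 2 * z) * (a * c * (a' * c')) = -((x + y + 2 * z) * (a' * c') ^ 2) := by
      linear_combination a' * c' * hr.1
    have hle : (x + y - 2 * z) * (a * c * (a' * c')) ≤ 0 := by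
      rw [e1]
      have : 0 ≤ (x + y + 2 * z) * (a' * c') ^ 2 := by positivity
      linarith
    rcases eq_or_ne (x + y - 2 * z) 0 with h0 | h0
    · rw [h0, zero_mul, eq_comm, neg_eq_zero] at e1
      have := (mul_eq_zero.1 e1).resolve_left (by positivity)
      rw [pow_eq_zero_iff two_ne_zero |>.1 this]
      simp
    · refine nonneg_of_mul_nonneg_left (b := (x + y - 2 * z) ^ 2) ?_ (by positivity)
      have := mul_nonneg_of_nonpos_of_nonpos hP.sum_le hle
      linarith
  refine ⟨κ, hκ, hP, ?_⟩
  have hxz' := sub_ne_zero.2 hxz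
  have hyz' := sub_ne_zero.2 hyz
  obtain ⟨σ, σ', δ, hσ, hσ', hδ, e1, e2, e3, e4⟩ := exists_signs (p := (y - z) ^ 2 * a)
    (q := (y + z) ^ 2 * a') (r := (x - z) ^ 2 * c) (s := (x + z) ^ 2 * c') hκ (by
      have : 0 ≤ (y - z) ^ 2 * (y + z) ^ 2 * (x - z) ^ 2 * (x + z) ^ 2 := by positivity
      have := mul_nonneg this hsign
      linarith)
  have q1 := (sq_eq_GR_iff (g := g) (x := x) (a := a) 1 (by rwa [one_mul])).2 (by rw [one_mul, a1])
  have q2 := (sq_eq_GR_iff (g := g) (x := x) (y := y) (z := z) (a := a') (-1)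
    (by linarith)).2 (by rw [neg_one_mul, a2]; ring)
  have q3 := (sq_eq_GR_iff (g := g) (x := y) (y := x) (a := c) 1 (by rwa [one_mul])).2
    (by rw [one_mul, c1])
  have q4 := (sq_eq_GR_iff (g := g) (x := y) (y := x) (z := z) (a := c') (-1)
    (by linarith)).2 (by rw [neg_one_mul, c2]; ring)
  rw [one_mul] at q1 q3
  rw [neg_one_mul, sub_neg_eq_add] at q2 q4
  refine ⟨σ, σ', δ, hσ, hσ', hδ, ?_, ?_, ?_, ?_⟩
  · rw [← q1, Real.sqrt_sq_eq_abs]; exact e1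
  · rw [← q2, Real.sqrt_sq_eq_abs]; exact e2
  · rw [← q3, Real.sqrt_sq_eq_abs]; exact e3
  · rw [← q4, Real.sqrt_sq_eq_abs]; exact e4

/-- Conversely, momenta of the stated form are steady. -/
lemma IsPlanar.isSteady (h : IsPlanar g κ x y z) (hκ : κ = 1 ∨ κ = -1) (hy : 0 < y) (hyx : y < x)
    (hz : 0 < z) (hxz : x ≠ z) (hyz : y ≠ z) {σ σ' δ : ℝ} (hσ : σ = 1 ∨ σ = -1)
    (hσ' : σ' = 1 ∨ σ' = -1) (hδ : δ = 1 ∨ δ = -1)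
    (e1 : (y - z) ^ 2 * a = σ * √(GR g 1 x y z))
    (e2 : (y + z) ^ 2 * a' = σ * δ * √(GR g (-1) x y z))
    (e3 : (x - z) ^ 2 * c = σ' * √(GR g 1 y x z))
    (e4 : (x + z) ^ 2 * c' = σ' * (κ * δ) * √(GR g (-1) y x z)) :
    PairRelation x y z a a' c c' ∧
      Balance (C g 1 x y z) (C g 2 x y z) x y z a a' c c' 0 0 := by
  have hx := hy.trans hyx
  obtain ⟨r1, r2, r3, r4⟩ := h.GR_nonneg hκ hy hyx hz
  have hxz' := sub_ne_zero.2 hxz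
  have hyz' := sub_ne_zero.2 hyz
  have sq_of : ∀ {p τ A : ℝ}, 0 ≤ A → (τ = 1 ∨ τ = -1) → p = τ * √A → p ^ 2 = A := by
    rintro p τ A hA hτ rfl
    rw [mul_pow, Real.sq_sqrt hA, sq, sign_mul_self hτ, one_mul]
  have a1 := (sq_eq_GR_iff (g := g) (x := x) (y := y) (z := z) (a := a) 1 (by rwa [one_mul])).1
    (by rw [one_mul]; exact sq_of r1 hσ e1)
  have a2 := (sq_eq_GR_iff (g := g) (x := x) (y := y) (z := z) (a := a') (-1) (by linarith)).1
    (by rw [neg_one_mul, sub_neg_eq_add]; exact sq_of r2 (sign_mul hσ hδ) e2)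
  have c1 := (sq_eq_GR_iff (g := g) (x := y) (y := x) (z := z) (a := c) 1 (by rwa [one_mul])).1
    (by rw [one_mul]; exact sq_of r3 hσ' e3)
  have c2 := (sq_eq_GR_iff (g := g) (x := y) (y := x) (z := z) (a := c') (-1) (by linarith)).1
    (by rw [neg_one_mul, sub_neg_eq_add]; exact sq_of r4 (sign_mul hσ' (sign_mul hκ hδ)) e4)
  rw [one_mul] at a1 c1
  rw [neg_one_mul, ← sub_eq_add_neg] at a2 c2
  have hsign : 0 ≤ κ * (a * c * (a' * c')) := by
    have hpos : 0 < (y - z) ^ 2 * (y + z) ^ 2 * (x - z) ^ 2 * (x + z) ^ 2 := by positivity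
    refine nonneg_of_mul_nonneg_right (a := (y - z) ^ 2 * (y + z) ^ 2 * (x - z) ^ 2 * (x + z) ^ 2)
      ?_ hpos
    have : (y - z) ^ 2 * (y + z) ^ 2 * (x - z) ^ 2 * (x + z) ^ 2 * (κ * (a * c * (a' * c')))
        = (σ * σ) * (σ' * σ') * (κ * κ) * (δ * δ) * (√(GR g 1 x y z) * √(GR g (-1) x y z)
          * √(GR g 1 y x z) * √(GR g (-1) y x z)) := by
      calc _ = κ * (((y - z) ^ 2 * a) * ((y + z) ^ 2 * a') * ((x - z) ^ 2 * c)
            * ((x + z) ^ 2 * c')) := by ring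
        _ = _ := by rw [e1, e2, e3, e4]; ring
    rw [this, sign_mul_self hσ, sign_mul_self hσ', sign_mul_self hκ, sign_mul_self hδ]
    positivity
  refine ⟨pairRelation_of_planarScale hx hy hz a1 a2 c1 c2 ?_ ?_,
    balance_of_planarScale (by nlinarith) h.D_ne_zero a1 a2 c1 c2⟩
  · have := mul_nonpos_of_nonpos_of_nonneg h.sum_le hsign
    refine le_of_eq_of_le ?_ this
    linear_combination (-(x + y - 2 * z) * (a * c * (a' * c'))) * sign_mul_self hκ
  · have := mul_nonpos_of_nonpos_of_nonneg h.diff_le hsign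
    have := mul_nonpos_of_nonneg_of_nonpos (by linarith : 0 ≤ x - y + 2 * z) this
    refine le_of_eq_of_le ?_ this
    linear_combination (-((x - y) ^ 2 - 4 * z ^ 2) * (a * c * (a' * c'))) * sign_mul_self hκ

end

/-! ### Identification of the existence regions -/

section regions

variable {g : ℝ} {b : V2}

lemma D_pos_of_sum_le {x y z : ℝ} (hy : 0 < y) (hyz : y < z) (hzx : z < x) (h : x + y ≤ 2 * z) :
    0 < D x y z := by
  -- `D` decreases in `x`, and at `x = 2z - y` it equals `(2z - y) y (2z² + 2yz - y²)`
  have h1 : x ^ 2 ≤ (2 * z - y) ^ 2 := by nlinarith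
  have h2 : 0 < z ^ 2 - y ^ 2 := by nlinarith
  have h3 : 0 < (2 * z - y) * y * (2 * z ^ 2 + 2 * y * z - y ^ 2) := by
    have : 0 < 2 * z - y := by linarith
    have : 0 < 2 * z ^ 2 + 2 * y * z - y ^ 2 := by nlinarith
    positivity
  unfold D
  nlinarith [mul_le_mul_of_nonneg_right h1 h2.le]

/-- The region of type I. -/
lemma isPlanar_one_iff {x y z : ℝ} (hg : 0 < g) (hy : 0 < y) (hyz : y < z) (hzx : z < x) :
    IsPlanar g 1 x y z ↔ x + y ≤ 2 * z := by
  have hz := hy.trans hyz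
  have hx := hz.trans hzx
  refine ⟨fun h => by have := h.sum_le; linarith, fun h => ?_⟩
  have hP := C_pos hg hx hy hz (n := 1) (by norm_num)
  have hQ := C_pos hg hx hy hz (n := 2) (by norm_num)
  have hD := D_pos_of_sum_le hy hyz hzx h
  have hxy : 0 < x ^ 2 - y ^ 2 := by nlinarith
  have hxz : 0 < x ^ 2 - z ^ 2 := by nlinarith
  have hzy : 0 < z ^ 2 - y ^ 2 := by nlinarith
  have hG : G g x y z < 0 := by
    unfold G
    have e1 : y ^ 2 - 4 * z ^ 2 < 0 := by nlinarith
    have : 0 < z ^ 2 * C g 1 x y z + C g 2 x y z := by positivity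
    nlinarith [mul_pos (mul_pos (pow_pos hx 2) hzy) hP, mul_pos (neg_pos.2 e1) this]
  have hG' : G g y x z < 0 := by
    unfold G
    rw [C_swap_left g 1 x, C_swap_left g 2 x]
    have e1 : x ^ 2 - 4 * z ^ 2 < 0 := by nlinarith
    -- the coefficient of `C₁` increases in `x`, and is negative at `x = 2z - y`
    have e2 : y ^ 2 * (x ^ 2 - z ^ 2) + (x ^ 2 - 4 * z ^ 2) * z ^ 2 < 0 := by
      have h1 : x ^ 2 ≤ (2 * z - y) ^ 2 := by nlinarith
      have h2 : 0 < y * (4 * z ^ 2 * (z - y) + y ^ 2 * (4 * z - y)) := by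
        have : 0 < z - y := by linarith
        have : 0 < 4 * z - y := by linarith
        positivity
      nlinarith [mul_le_mul_of_nonneg_right h1 (by positivity : 0 ≤ y ^ 2 + z ^ 2)]
    nlinarith [mul_pos (neg_pos.2 e2) hP, mul_pos (neg_pos.2 e1) hQ]
  refine ⟨hD.ne', ?_, ?_, by linarith, by linarith⟩
  · rw [one_mul]
    exact mul_neg_of_pos_of_neg (div_pos hxz hxy) (div_neg_of_neg_of_pos hG hD)
  · unfold planarScale
    rw [D_comm]
    exact mul_neg_of_pos_of_neg (div_pos_of_neg_of_neg (by linarith) (by linarith))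
      (div_neg_of_neg_of_pos hG' hD)

/-- The region of type II. -/
lemma isPlanar_neg_one_iff_of_lt {x y z : ℝ} (hg : 0 < g) (hy : 0 < y) (hyz : y < z)
    (hzx : z < x) : IsPlanar g (-1) x y z ↔ 2 * z + y ≤ x ∧ D x y z < 0 := by
  have hz := hy.trans hyz
  have hx := hz.trans hzx
  have hP := C_pos hg hx hy hz (n := 1) (by norm_num)
  have hQ := C_pos hg hx hy hz (n := 2) (by norm_num)
  have hxy : 0 < x ^ 2 - y ^ 2 := by nlinarith
  have hxz : 0 < x ^ 2 - z ^ 2 := by nlinarith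
  have hzy : 0 < z ^ 2 - y ^ 2 := by nlinarith
  have hG' : 2 * z + y ≤ x → 0 < G g y x z := by
    intro h
    unfold G
    rw [C_swap_left g 1 x, C_swap_left g 2 x]
    have : 0 < x ^ 2 - 4 * z ^ 2 := by nlinarith
    positivity
  have hfac : 0 < (y ^ 2 - z ^ 2) / (y ^ 2 - x ^ 2) :=
    div_pos_of_neg_of_neg (by linarith) (by linarith)
  constructor
  · intro h
    have hle : 2 * z + y ≤ x := by have := h.diff_le; linarith
    refine ⟨hle, ?_⟩
    have := h.scale_short
    unfold planarScale at this
    rw [D_comm] at this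
    by_contra! hD
    exact absurd this (not_lt.2 (mul_nonneg hfac.le (div_nonneg (hG' hle).le hD)))
  · rintro ⟨hle, hD⟩
    have hG : G g x y z < 0 := by
      unfold G
      have e1 : y ^ 2 - 4 * z ^ 2 < 0 := by nlinarith
      have : 0 < z ^ 2 * C g 1 x y z + C g 2 x y z := by positivity
      nlinarith [mul_pos (mul_pos (pow_pos hx 2) hzy) hP, mul_pos (neg_pos.2 e1) this]
    refine ⟨hD.ne, ?_, ?_, by linarith, by linarith⟩
    · have := mul_pos (div_pos hxz hxy) (div_pos_of_neg_of_neg hG hD)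
      unfold planarScale
      linarith
    · unfold planarScale
      rw [D_comm]
      exact mul_neg_of_pos_of_neg hfac (div_neg_of_pos_of_neg (hG' hle) hD)

/-- The region of type III. -/
lemma isPlanar_iff_of_gt {κ x y z : ℝ} (hg : 0 < g) (hz : 0 < z) (hzy : z < y) (hyx : y < x)
    (hκ : κ = 1 ∨ κ = -1) :
    IsPlanar g κ x y z ↔ κ = -1 ∧ y + 2 * z ≤ x ∧ 0 < G g x y z := by
  have hy := hz.trans hzy
  have hx := hy.trans hyx
  have hP := C_pos hg hx hy hz (n := 1) (by norm_num)
  have hQ := C_pos hg hx hy hz (n := 2) (by norm_num)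
  have hxy : 0 < x ^ 2 - y ^ 2 := by nlinarith
  have hyz : 0 < y ^ 2 - z ^ 2 := by nlinarith
  have hxz : 0 < x ^ 2 - z ^ 2 := by linarith
  have hD : 0 < D x y z := by
    unfold D
    nlinarith [mul_pos hxy hyz, sq_nonneg (y ^ 2 - 2 * z ^ 2), mul_pos hz hy]
  constructor
  · intro h
    rcases hκ with rfl | rfl
    · have := h.sum_le
      linarith
    · refine ⟨rfl, by have := h.diff_le; linarith, ?_⟩
      have := h.scale_long
      by_contra! hG
      have : planarScale g x y z ≤ 0 := mul_nonpos_of_nonneg_of_nonpos (div_pos hxz hxy).le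
        (div_nonpos_of_nonpos_of_nonneg hG hD.le)
      linarith
  · rintro ⟨rfl, hle, hG⟩
    have hG' : 0 < G g y x z := by
      unfold G
      rw [C_swap_left g 1 x, C_swap_left g 2 x]
      have : 0 < x ^ 2 - 4 * z ^ 2 := by nlinarith
      positivity
    refine ⟨hD.ne', ?_, ?_, by linarith, by linarith⟩
    · have := mul_pos (div_pos hxz hxy) (div_pos hG hD)
      unfold planarScale
      linarith
    · unfold planarScale
      rw [D_comm]
      exact mul_neg_of_neg_of_pos (div_neg_of_pos_of_neg hyz (by linarith)) (div_pos hG' hD)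

/-- The momenta never lie in the plane of the two shorter axes. -/
lemma not_isPlanar_of_lt {κ x y z : ℝ} (hg : 0 < g) (hy : 0 < y) (hyx : y < x) (hxz : x < z)
    (hκ : κ = 1 ∨ κ = -1) : ¬ IsPlanar g κ x y z := by
  intro h
  have hx := hy.trans hyx
  have hz := hx.trans hxz
  rcases hκ with rfl | rfl
  · have hP := C_pos hg hx hy hz (n := 1) (by norm_num)
    have hQ := C_pos hg hx hy hz (n := 2) (by norm_num)
    have hzy : 0 < z ^ 2 - y ^ 2 := by nlinarith
    have hG : G g x y z < 0 := by
      unfold G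
      have e1 : y ^ 2 - 4 * z ^ 2 < 0 := by nlinarith
      have : 0 < z ^ 2 * C g 1 x y z + C g 2 x y z := by positivity
      nlinarith [mul_pos (mul_pos (pow_pos hx 2) hzy) hP, mul_pos (neg_pos.2 e1) this]
    have hD : 0 < D x y z := by
      unfold D
      have : 0 < z ^ 2 - x ^ 2 := by nlinarith
      nlinarith [mul_pos this hzy, pow_pos hz 4]
    have := h.scale_long
    have : 0 < planarScale g x y z := mul_pos_of_neg_of_neg
      (div_neg_of_neg_of_pos (by nlinarith) (by nlinarith)) (div_neg_of_neg_of_pos hG hD)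
    linarith
  · have := h.diff_le
    linarith

lemma mem_region_I (hg : 0 < g) (hb : b ∈ configSpace) :
    b ∈ region g .I ↔ IsPlanar g 1 (b₁ b) (b₃ b) (b₂ b) := by
  obtain ⟨h3, h32, h21, -⟩ := semiaxes_of_mem hb
  rw [isPlanar_one_iff hg h3 h32 h21]
  exact ⟨fun h => by linarith [h.2], fun h => ⟨hb, by linarith⟩⟩

lemma mem_region_II (hg : 0 < g) (hb : b ∈ configSpace) :
    b ∈ region g .II ↔ IsPlanar g (-1) (b₁ b) (b₃ b) (b₂ b) := by
  obtain ⟨h3, h32, h21, -⟩ := semiaxes_of_mem hb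
  rw [isPlanar_neg_one_iff_of_lt hg h3 h32 h21]
  exact ⟨fun h => h.2, fun h => ⟨hb, h⟩⟩

lemma mem_region_III (hg : 0 < g) (hb : b ∈ configSpace) {κ : ℝ} (hκ : κ = 1 ∨ κ = -1) :
    IsPlanar g κ (b₁ b) (b₂ b) (b₃ b) ↔ κ = -1 ∧ b ∈ region g .III := by
  obtain ⟨h3, h32, h21, -⟩ := semiaxes_of_mem hb
  rw [isPlanar_iff_of_gt hg h3 h32 h21 hκ]
  exact ⟨fun h => ⟨h.1, hb, h.2⟩, fun h => ⟨h.1, h.2.2⟩⟩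

lemma mem_configSpace_of_mem_region {α : EllipsoidType} (h : b ∈ region g α) : b ∈ configSpace := by
  cases α <;> exact h.1

lemma momentaAreReal (hg : 0 < g) {α : EllipsoidType} (h : b ∈ region g α) :
    MomentaAreReal g α b := by
  have hb := mem_configSpace_of_mem_region h
  obtain ⟨h3, h32, h21, -⟩ := semiaxes_of_mem hb
  have h2 := h3.trans h32
  have h1 := h2.trans h21
  cases α with
  | S2 => exact ⟨(mul_pos h1 h3).ne', (GS_one_pos hg h3 h32 h21).le, h.2⟩
  | S3 => exact ⟨(mul_pos h1 h2).ne', h.2, h.2.trans (GS_one_lt_GS_neg_one hg h3 h32 h21 h.2).le⟩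
  | I => exact ((mem_region_I hg hb).1 h).nrIsReal (Or.inl rfl) h3 (h32.trans h21) h2
  | II => exact ((mem_region_II hg hb).1 h).nrIsReal (Or.inr rfl) h3 (h32.trans h21) h2
  | III => exact ((mem_region_III hg hb (Or.inr rfl)).2 ⟨rfl, h⟩).nrIsReal (Or.inr rfl) h2 h21 h3

end regions

/-! ### The momenta -/

section momenta

variable (g ε : ℝ) (b : V2)

lemma μ_S2 : μ g .S2 ε b = ![0, NS g ε (b₁ b) (b₂ b) (b₃ b), 0] := by
  ext i; fin_cases i <;> simp [μ, e₂]

lemma μ_S3 : μ g .S3 ε b = ![0, 0, NS g ε (b₁ b) (b₃ b) (b₂ b)] := by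
  ext i; fin_cases i <;> simp [μ, e₃]

lemma μ_I : μ g .I ε b =
    ![NR g ε (b₁ b) (b₃ b) (b₂ b), 0, NR g ε (b₃ b) (b₁ b) (b₂ b)] := by
  ext i; fin_cases i <;> simp [μ, e₁, e₃]

lemma μ_II : μ g .II ε b =
    ![NR g ε (b₁ b) (b₃ b) (b₂ b), 0, NR g (-ε) (b₃ b) (b₁ b) (b₂ b)] := by
  ext i; fin_cases i <;> simp [μ, e₁, e₃]

lemma μ_III : μ g .III ε b =
    ![NR g ε (b₁ b) (b₂ b) (b₃ b), NR g (-ε) (b₂ b) (b₁ b) (b₃ b), 0] := by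
  ext i; fin_cases i <;> simp [μ, e₁, e₂]

end momenta

lemma vec_eq_zero_iff {α β γ : ℝ} : (![α, β, γ] : V3) = 0 ↔ α = 0 ∧ β = 0 ∧ γ = 0 := by
  simp [funext_iff, Fin.forall_fin_succ]

lemma half_sqrt_sub_eq_zero_iff {A B : ℝ} (hA : 0 ≤ A) (hB : 0 ≤ B) :
    1 / 2 * (√A + -1 * √B) = 0 ↔ A = B := by
  rw [← Real.sqrt_inj hA hB]
  constructor <;> intro h <;> linarith

lemma half_sqrt_add_ne_zero {A B : ℝ} (h : 0 < A ∨ 0 < B) : 1 / 2 * (√A + 1 * √B) ≠ 0 := by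
  rcases h with h | h
  · have := Real.sqrt_pos.2 h
    positivity
  · have := Real.sqrt_pos.2 h
    positivity

/-- For momenta in a principal plane, the equality of sum and difference momenta along either axis
is the same condition. -/
lemma GR_one_eq_iff {g x y z : ℝ} (hy : 0 < y) (hz : 0 < z) (hs : planarScale g x y z ≠ 0) :
    GR g 1 x y z = GR g (-1) x y z ↔
      x ^ 2 * y ^ 2 + x ^ 2 * z ^ 2 + y ^ 2 * z ^ 2 - 3 * z ^ 4 = 0 := by
  have e : GR g (-1) x y z - GR g 1 x y z = planarScale g x y z * (8 * y * z) *
      (x ^ 2 * y ^ 2 + x ^ 2 * z ^ 2 + y ^ 2 * z ^ 2 - 3 * z ^ 4) := by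
    rw [GR_eq, GR_eq]; ring
  have hne : planarScale g x y z * (8 * y * z) ≠ 0 := mul_ne_zero hs (by positivity)
  constructor
  · intro h
    rw [h, sub_self, eq_comm] at e
    exact (mul_eq_zero.1 e).resolve_left hne
  · intro h
    rw [h, mul_zero] at e
    linarith

/-- A momentum vanishes only on the irrotational curves, where it is `μ⁻` and not `μ⁺`. -/
lemma momenta_eq_zero {g : ℝ} (hg : 0 < g) {α : EllipsoidType} {b : V2} (h : b ∈ region g α) :
    μ g α 1 b ≠ 0 ∧ (μ g α (-1) b = 0 ↔ OnIrrotationalCurve g α b) := by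
  have hb := mem_configSpace_of_mem_region h
  obtain ⟨h3, h32, h21, -⟩ := semiaxes_of_mem hb
  have h2 := h3.trans h32
  have h31 := h32.trans h21
  cases α with
  | S2 =>
    have hp := GS_one_pos hg h3 h32 h21
    simp only [μ_S2, ne_eq, vec_eq_zero_iff, true_and, and_true, NS]
    exact ⟨half_sqrt_add_ne_zero (Or.inl hp), half_sqrt_sub_eq_zero_iff hp.le h.2⟩
  | S3 =>
    have hlt := GS_one_lt_GS_neg_one hg h3 h32 h21 h.2
    simp only [μ_S3, ne_eq, vec_eq_zero_iff, true_and, NS, OnIrrotationalCurve, iff_false]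
    refine ⟨half_sqrt_add_ne_zero (Or.inr (h.2.trans_lt hlt)), ?_⟩
    rw [half_sqrt_sub_eq_zero_iff h.2 (h.2.trans hlt.le)]
    exact hlt.ne
  | I =>
    have hP := (mem_region_I hg hb).1 h
    obtain ⟨r1, r2, r3, r4⟩ := hP.GR_nonneg (Or.inl rfl) h3 h31 h2
    have hs : planarScale g (b₁ b) (b₃ b) (b₂ b) ≠ 0 := by
      have := hP.scale_long
      intro h0
      simp [h0] at this
    simp only [μ_I, ne_eq, vec_eq_zero_iff, true_and, NR, OnIrrotationalCurve]
    refine ⟨fun h0 => half_sqrt_add_ne_zero (Or.inl (hP.GR_one_long_pos h3 h31 h2 h32.ne)) h0.1, ?_⟩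
    rw [half_sqrt_sub_eq_zero_iff r1 r2, half_sqrt_sub_eq_zero_iff r3 r4, GR_one_eq_iff h3 h2 hs,
      GR_one_eq_iff (h2.trans h21) h2 hP.scale_short.ne]
    constructor
    · rintro ⟨h0, -⟩
      linarith
    · intro h0
      constructor <;> linarith
  | II =>
    have hP := (mem_region_II hg hb).1 h
    simp only [μ_II, ne_eq, vec_eq_zero_iff, true_and, NR, OnIrrotationalCurve, iff_false, neg_neg]
    exact ⟨fun h0 => half_sqrt_add_ne_zero (Or.inr (hP.GR_neg_one_long_pos h3 h31 h2)) h0.1,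
      fun h0 => half_sqrt_add_ne_zero (Or.inl (hP.GR_one_short_pos h3 h31 h2 h21.ne')) h0.2⟩
  | III =>
    have hP := (mem_region_III hg hb (Or.inr rfl)).2 ⟨rfl, h⟩
    simp only [μ_III, ne_eq, vec_eq_zero_iff, and_true, NR, OnIrrotationalCurve, iff_false, neg_neg]
    exact ⟨fun h0 => half_sqrt_add_ne_zero (Or.inr (hP.GR_neg_one_long_pos h2 h21 h3)) h0.1,
      fun h0 => half_sqrt_add_ne_zero (Or.inl (hP.GR_one_short_pos h2 h21 h3 h31.ne')) h0.2⟩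

/-! ### Classification -/

/-- The symmetries `±Rᵢ` are all the diagonal matrices with entries `±1`. -/
lemma exists_symmetry_iff (P : (V3 → V3) → Prop) :
    (∃ i : Fin 4, ∃ ε : ℝ, (ε = 1 ∨ ε = -1) ∧ P (fun v => ε • (R i *ᵥ v))) ↔
      ∃ s : V3, (∀ k, s k = 1 ∨ s k = -1) ∧ P (fun v => s * v) := by
  have hdiag : ∀ i, ∃ d : V3, (∀ k, d k = 1 ∨ d k = -1) ∧ R i = diagonal d := by
    intro i
    fin_cases i
    · exact ⟨1, by simp, diagonal_one.symm⟩
    · exact ⟨![1, -1, -1], by intro k; fin_cases k <;> simp, rfl⟩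
    · exact ⟨![-1, 1, -1], by intro k; fin_cases k <;> simp, rfl⟩
    · exact ⟨![-1, -1, 1], by intro k; fin_cases k <;> simp, rfl⟩
  constructor
  · rintro ⟨i, ε, hε, h⟩
    obtain ⟨d, hd, hR⟩ := hdiag i
    refine ⟨ε • d, fun k => sign_mul hε (hd k), ?_⟩
    convert h using 2 with v
    rw [hR]
    ext k
    simp [mulVec_diagonal, mul_assoc]
  · rintro ⟨s, hs, h⟩
    have hR : ∀ i (ε : ℝ) (d : V3), R i = diagonal d → ε • d = s →
        (fun v : V3 => ε • (R i *ᵥ v)) = fun v => s * v := by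
      intro i ε d hRi hd
      ext v k
      rw [hRi, ← hd]
      simp [mulVec_diagonal, mul_assoc]
    have main : ∀ i (ε : ℝ) (d : V3), (ε = 1 ∨ ε = -1) → R i = diagonal d → ε • d = s →
        ∃ i : Fin 4, ∃ ε : ℝ, (ε = 1 ∨ ε = -1) ∧ P (fun v => ε • (R i *ᵥ v)) := by
      intro i ε d hε hRi hd
      exact ⟨i, ε, hε, (hR i ε d hRi hd).symm ▸ h⟩
    have ext3 : ∀ (ε α β γ : ℝ), s 0 = ε * α → s 1 = ε * β → s 2 = ε * γ →
        ε • (![α, β, γ] : V3) = s := by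
      intro ε α β γ h0 h1 h2
      ext k
      fin_cases k <;> simp [h0, h1, h2]
    have hone : R 0 = diagonal ![1, 1, 1] := by
      have e : (![1, 1, 1] : V3) = 1 := by ext k; fin_cases k <;> rfl
      rw [e]
      exact diagonal_one.symm
    -- the overall sign `ε` is the product of the three entries
    rcases hs 0 with h0 | h0 <;> rcases hs 1 with h1 | h1 <;> rcases hs 2 with h2 | h2
    · exact main 0 1 _ (Or.inl rfl) hone (ext3 _ _ _ _ (by simp [h0]) (by simp [h1]) (by simp [h2]))
    · exact main 3 (-1) _ (Or.inr rfl) rfl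
        (ext3 _ _ _ _ (by simp [h0]) (by simp [h1]) (by simp [h2]))
    · exact main 2 (-1) _ (Or.inr rfl) rfl
        (ext3 _ _ _ _ (by simp [h0]) (by simp [h1]) (by simp [h2]))
    · exact main 1 1 _ (Or.inl rfl) rfl
        (ext3 _ _ _ _ (by simp [h0]) (by simp [h1]) (by simp [h2]))
    · exact main 1 (-1) _ (Or.inr rfl) rfl
        (ext3 _ _ _ _ (by simp [h0]) (by simp [h1]) (by simp [h2]))
    · exact main 2 1 _ (Or.inl rfl) rfl
        (ext3 _ _ _ _ (by simp [h0]) (by simp [h1]) (by simp [h2]))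
    · exact main 3 1 _ (Or.inl rfl) rfl
        (ext3 _ _ _ _ (by simp [h0]) (by simp [h1]) (by simp [h2]))
    · exact main 0 (-1) _ (Or.inr rfl) hone
        (ext3 _ _ _ _ (by simp [h0]) (by simp [h1]) (by simp [h2]))

lemma equivalent_iff {p q : Phase} : Equivalent p q ↔ ∃ s : V3, (∀ k, s k = 1 ∨ s k = -1) ∧
    p = (q.1, q.2.1, (s * q.2.2.1, s * q.2.2.2)) :=
  exists_symmetry_iff fun f => p = (q.1, q.2.1, (f q.2.2.1, f q.2.2.2))

lemma irrEquivalent_iff {p q : IrrPhase} :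
    IrrEquivalent p q ↔ ∃ s : V3, (∀ k, s k = 1 ∨ s k = -1) ∧ p = (q.1, q.2.1, s * q.2.2) :=
  exists_symmetry_iff fun f => p = (q.1, q.2.1, f q.2.2)

lemma Balance.of_C_swap {g x y z a a' c c' d d' : ℝ}
    (h : Balance (C g 1 x y z) (C g 2 x y z) x y z a a' c c' d d') :
    Balance (C g 1 x z y) (C g 2 x z y) x z y a a' d d' c c' := by
  rw [C_swap_right g 1 x y, C_swap_right g 2 x y, balance_swap_right]
  exact h

lemma Balance.of_C_rotate {g x y z a a' c c' d d' : ℝ}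
    (h : Balance (C g 1 x y z) (C g 2 x y z) x y z a a' c c' d d') :
    Balance (C g 1 y z x) (C g 2 y z x) y z x c c' d d' a a' := by
  refine Balance.of_C_swap ?_
  rw [C_swap_left g 1 x y, C_swap_left g 2 x y, balance_swap_left]
  exact h

/-- Steady momenta are, up to signs of the components, those of one of the five types. -/
theorem exists_type_of_isSteady {g : ℝ} (hg : 0 < g) {b : V2} (hb : b ∈ configSpace) {m : V3 × V3}
    (h : IsSteady (C g 1 (b₁ b) (b₂ b) (b₃ b)) (C g 2 (b₁ b) (b₂ b) (b₃ b)) (b₁ b) (b₂ b) (b₃ b)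
      (sumVelocity b m) (diffVelocity b m)) :
    ∃ α, b ∈ region g α ∧ ∃ δ : ℝ, (δ = 1 ∨ δ = -1) ∧ ∃ s : V3, (∀ k, s k = 1 ∨ s k = -1) ∧
      m = (s * μ g α δ b, s * μ g α (-δ) b) := by
  obtain ⟨h3, h32, h21, -⟩ := semiaxes_of_mem hb
  have h2 := h3.trans h32
  have h31 := h32.trans h21
  have h1 := h2.trans h21
  obtain ⟨S0, S1, S2, D0, D1, D2⟩ := momenta_eq hb m
  obtain ⟨p01, p02, p12, hB⟩ := h
  have hP := C_pos hg h1 h2 h3 (n := 1) (by norm_num)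
  have hQ := C_pos hg h1 h2 h3 (n := 2) (by norm_num)
  generalize sumVelocity b m = u at *
  generalize diffVelocity b m = v at *
  obtain ⟨ml, mr⟩ := m
  simp only at S0 S1 S2 D0 D1 D2
  by_cases c0 : u 0 ≠ 0 ∨ v 0 ≠ 0
  · by_cases c1 : u 1 ≠ 0 ∨ v 1 ≠ 0
    · by_cases c2 : u 2 ≠ 0 ∨ v 2 ≠ 0
      · exact (p01.false_of_three p02 c0 c1 c2 h2 h3 h32).elim
      · push Not at c2
        rw [c2.1, c2.2] at hB
        obtain ⟨κ, hκ, hI, σ, σ', δ, hσ, hσ', hδ, e1, e2, e3, e4⟩ :=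
          exists_isPlanar hg h2 h21 h3 h31.ne' h32.ne' p01 c0 c1 hB
        obtain ⟨rfl, hr⟩ := (mem_region_III hg hb hκ).1 hI
        refine ⟨.III, hr, δ, hδ, ![σ, σ', 1], by intro k; fin_cases k <;> simp [hσ, hσ'], ?_⟩
        rw [c2.1, mul_zero] at S2
        rw [c2.2, mul_zero] at D2
        rw [← S0] at e1
        rw [← D0] at e2
        rw [← S1] at e3
        rw [← D1] at e4
        rw [μ_III, μ_III]
        ext k <;> fin_cases k <;> simp [NR] <;> linarith
    · push Not at c1
      rw [c1.1, c1.2] at hB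
      by_cases c2 : u 2 ≠ 0 ∨ v 2 ≠ 0
      · obtain ⟨κ, hκ, hI, σ, σ', δ, hσ, hσ', hδ, e1, e2, e3, e4⟩ :=
          exists_isPlanar hg h3 h31 h2 h21.ne' h32.ne p02 c0 c2 hB.of_C_swap
        rw [c1.1, mul_zero] at S1
        rw [c1.2, mul_zero] at D1
        rw [sub_sq_comm, ← S0] at e1
        rw [add_comm, ← D0] at e2
        rw [← S2] at e3
        rw [← D2] at e4
        rcases hκ with rfl | rfl
        · refine ⟨.I, (mem_region_I hg hb).2 hI, δ, hδ, ![σ, 1, σ'],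
            by intro k; fin_cases k <;> simp [hσ, hσ'], ?_⟩
          rw [μ_I, μ_I]
          ext k <;> fin_cases k <;> simp [NR] <;> linarith
        · refine ⟨.II, (mem_region_II hg hb).2 hI, δ, hδ, ![σ, 1, σ'],
            by intro k; fin_cases k <;> simp [hσ, hσ'], ?_⟩
          rw [μ_II, μ_II]
          ext k <;> fin_cases k <;> simp [NR] <;> linarith
      · push Not at c2
        rw [c2.1, c2.2] at hB
        exact (not_balance_longest hP hQ h3 h32 h21 hB).elim
  · push Not at c0
    by_cases c1 : u 1 ≠ 0 ∨ v 1 ≠ 0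
    · by_cases c2 : u 2 ≠ 0 ∨ v 2 ≠ 0
      · rw [c0.1, c0.2] at hB
        obtain ⟨κ, hκ, hI, -⟩ :=
          exists_isPlanar hg h3 h32 h1 h21.ne h31.ne p12 c1 c2 hB.of_C_rotate
        exact (not_isPlanar_of_lt hg h3 h32 h21 hκ hI).elim
      · push Not at c2
        rw [c0.1, c0.2, c2.1, c2.2] at hB
        obtain ⟨q1, q2⟩ := (balance_single_iff g h1 h3 h31.ne').1 hB
        rw [← S1] at q1
        rw [← D1] at q2
        rw [c0.1, mul_zero] at S0
        rw [c0.2, mul_zero] at D0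
        rw [c2.1, mul_zero] at S2
        rw [c2.2, mul_zero] at D2
        obtain ⟨σ, hσ, e1⟩ := exists_sign (ml 1 + mr 1)
        obtain ⟨τ, hτ, e2⟩ := exists_sign (ml 1 - mr 1)
        rw [← Real.sqrt_sq_eq_abs, q1] at e1
        rw [← Real.sqrt_sq_eq_abs, q2] at e2
        refine ⟨.S2, ⟨hb, q2 ▸ sq_nonneg _⟩, σ * τ, sign_mul hσ hτ, ![1, σ, 1],
          by intro k; fin_cases k <;> simp [hσ], ?_⟩
        rw [μ_S2, μ_S2]
        rcases hσ with rfl | rfl <;> ext k <;> fin_cases k <;> simp [NS] <;> linarith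
    · push Not at c1
      by_cases c2 : u 2 ≠ 0 ∨ v 2 ≠ 0
      · rw [c0.1, c0.2, c1.1, c1.2] at hB
        obtain ⟨q1, q2⟩ := (balance_single_iff g h1 h2 h21.ne').1 hB.of_C_swap
        rw [← S2] at q1
        rw [← D2] at q2
        rw [c0.1, mul_zero] at S0
        rw [c0.2, mul_zero] at D0
        rw [c1.1, mul_zero] at S1
        rw [c1.2, mul_zero] at D1
        obtain ⟨σ, hσ, e1⟩ := exists_sign (ml 2 + mr 2)
        obtain ⟨τ, hτ, e2⟩ := exists_sign (ml 2 - mr 2)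
        rw [← Real.sqrt_sq_eq_abs, q1] at e1
        rw [← Real.sqrt_sq_eq_abs, q2] at e2
        refine ⟨.S3, ⟨hb, q1 ▸ sq_nonneg _⟩, σ * τ, sign_mul hσ hτ, ![1, 1, σ],
          by intro k; fin_cases k <;> simp [hσ], ?_⟩
        rw [μ_S3, μ_S3]
        rcases hσ with rfl | rfl <;> ext k <;> fin_cases k <;> simp [NS] <;> linarith
      · push Not at c2
        rw [c1.1, c1.2, c2.1, c2.2] at hB
        exact (not_balance_longest hP hQ h3 h32 h21 hB).elim

/-- Conversely, the momenta of the five types are steady. -/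
theorem isSteady_of_mem_region {g : ℝ} (hg : 0 < g) {α : EllipsoidType} {b : V2}
    (hb : b ∈ region g α) {δ : ℝ} (hδ : δ = 1 ∨ δ = -1) {s : V3} (hs : ∀ k, s k = 1 ∨ s k = -1)
    {m : V3 × V3} (hm : m = (s * μ g α δ b, s * μ g α (-δ) b)) :
    IsSteady (C g 1 (b₁ b) (b₂ b) (b₃ b)) (C g 2 (b₁ b) (b₂ b) (b₃ b)) (b₁ b) (b₂ b) (b₃ b)
      (sumVelocity b m) (diffVelocity b m) := by
  have hbc := mem_configSpace_of_mem_region hb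
  obtain ⟨h3, h32, h21, -⟩ := semiaxes_of_mem hbc
  have h2 := h3.trans h32
  have h31 := h32.trans h21
  have h1 := h2.trans h21
  obtain ⟨S0, S1, S2, D0, D1, D2⟩ := momenta_eq hbc m
  have n0 : b₂ b - b₃ b ≠ 0 := by linarith
  have n1 : b₁ b - b₃ b ≠ 0 := by linarith
  have n2 : b₁ b - b₂ b ≠ 0 := by linarith
  have k0 : b₂ b + b₃ b ≠ 0 := by positivity
  have k1 : b₁ b + b₃ b ≠ 0 := by positivity
  have k2 : b₁ b + b₂ b ≠ 0 := by positivity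
  have zero_of : ∀ {w t : ℝ}, w ≠ 0 → 0 = w ^ 2 * t → t = 0 := fun hw ht =>
    (mul_eq_zero.1 ht.symm).resolve_left (pow_ne_zero 2 hw)
  have trivial₁ : ∀ x y z c c' : ℝ, PairRelation x y z 0 0 c c' := fun _ _ _ _ _ => by
    simp [PairRelation]
  have trivial₂ : ∀ x y z a a' : ℝ, PairRelation x y z a a' 0 0 := fun _ _ _ _ _ => by
    simp [PairRelation]
  have sq_of : ∀ {A σ : ℝ}, 0 ≤ A → (σ = 1 ∨ σ = -1) → (σ * √A) ^ 2 = A := by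
    intro A σ hA hσ
    rw [mul_pow, Real.sq_sqrt hA, sq, sign_mul_self hσ, one_mul]
  generalize sumVelocity b m = u at *
  generalize diffVelocity b m = v at *
  cases α with
  | S2 =>
    rw [μ_S2, μ_S2] at hm
    have u0 : u 0 = 0 := zero_of n0 (by rw [← S0]; simp [hm])
    have u2 : u 2 = 0 := zero_of n2 (by rw [← S2]; simp [hm])
    have v0 : v 0 = 0 := zero_of k0 (by rw [← D0]; simp [hm])
    have v2 : v 2 = 0 := zero_of k2 (by rw [← D2]; simp [hm])
    have e1 : m.1 1 + m.2 1 = s 1 * √(GS g 1 (b₁ b) (b₂ b) (b₃ b)) := by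
      simp [hm, NS]; ring
    have e2 : m.1 1 - m.2 1 = s 1 * δ * √(GS g (-1) (b₁ b) (b₂ b) (b₃ b)) := by
      simp [hm, NS]; ring
    refine ⟨?_, ?_, ?_, ?_⟩
    · rw [u0, v0]
      exact trivial₁ _ _ _ _ _
    · rw [u0, v0]
      exact trivial₁ _ _ _ _ _
    · rw [u2, v2]
      exact trivial₂ _ _ _ _ _
    · rw [u0, v0, u2, v2, balance_single_iff g h1 h3 h31.ne', ← S1, ← D1, e1, e2]
      exact ⟨sq_of (GS_one_pos hg h3 h32 h21).le (hs 1), sq_of hb.2 (sign_mul (hs 1) hδ)⟩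
  | S3 =>
    rw [μ_S3, μ_S3] at hm
    have u0 : u 0 = 0 := zero_of n0 (by rw [← S0]; simp [hm])
    have u1 : u 1 = 0 := zero_of n1 (by rw [← S1]; simp [hm])
    have v0 : v 0 = 0 := zero_of k0 (by rw [← D0]; simp [hm])
    have v1 : v 1 = 0 := zero_of k1 (by rw [← D1]; simp [hm])
    have e1 : m.1 2 + m.2 2 = s 2 * √(GS g 1 (b₁ b) (b₃ b) (b₂ b)) := by
      simp [hm, NS]; ring
    have e2 : m.1 2 - m.2 2 = s 2 * δ * √(GS g (-1) (b₁ b) (b₃ b) (b₂ b)) := by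
      simp [hm, NS]; ring
    have hlt := GS_one_lt_GS_neg_one hg h3 h32 h21 hb.2
    refine ⟨?_, ?_, ?_, ?_⟩
    · rw [u0, v0]
      exact trivial₁ _ _ _ _ _
    · rw [u0, v0]
      exact trivial₁ _ _ _ _ _
    · rw [u1, v1]
      exact trivial₁ _ _ _ _ _
    · rw [u0, v0, u1, v1]
      refine Balance.of_C_swap ((balance_single_iff g h1 h2 h21.ne').2 ?_)
      rw [← S2, ← D2, e1, e2]
      exact ⟨sq_of hb.2 (hs 2), sq_of (hb.2.trans hlt.le) (sign_mul (hs 2) hδ)⟩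
  | I =>
    rw [μ_I, μ_I] at hm
    have u1 : u 1 = 0 := zero_of n1 (by rw [← S1]; simp [hm])
    have v1 : v 1 = 0 := zero_of k1 (by rw [← D1]; simp [hm])
    obtain ⟨hr, hB⟩ := ((mem_region_I hg hbc).1 hb).isSteady (a := u 0) (a' := v 0) (c := u 2)
      (c' := v 2) (Or.inl rfl) h3 h31 h2 h21.ne' h32.ne (hs 0) (hs 2) hδ
      (by rw [sub_sq_comm, ← S0]; simp [hm, NR]; ring)
      (by rw [add_comm, ← D0]; simp [hm, NR]; ring)
      (by rw [← S2]; simp [hm, NR]; ring)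
      (by rw [← D2]; simp [hm, NR]; ring)
    refine ⟨?_, hr, ?_, ?_⟩ <;> rw [u1, v1]
    · exact trivial₂ _ _ _ _ _
    · exact trivial₁ _ _ _ _ _
    · exact hB.of_C_swap
  | II =>
    rw [μ_II, μ_II] at hm
    have u1 : u 1 = 0 := zero_of n1 (by rw [← S1]; simp [hm])
    have v1 : v 1 = 0 := zero_of k1 (by rw [← D1]; simp [hm])
    obtain ⟨hr, hB⟩ := ((mem_region_II hg hbc).1 hb).isSteady (a := u 0) (a' := v 0) (c := u 2)
      (c' := v 2) (Or.inr rfl) h3 h31 h2 h21.ne' h32.ne (hs 0) (hs 2) hδ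
      (by rw [sub_sq_comm, ← S0]; simp [hm, NR]; ring)
      (by rw [add_comm, ← D0]; simp [hm, NR]; ring)
      (by rw [← S2]; simp [hm, NR]; ring)
      (by rw [← D2]; simp [hm, NR]; ring)
    refine ⟨?_, hr, ?_, ?_⟩ <;> rw [u1, v1]
    · exact trivial₂ _ _ _ _ _
    · exact trivial₁ _ _ _ _ _
    · exact hB.of_C_swap
  | III =>
    rw [μ_III, μ_III] at hm
    have u2 : u 2 = 0 := zero_of n2 (by rw [← S2]; simp [hm])
    have v2 : v 2 = 0 := zero_of k2 (by rw [← D2]; simp [hm])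
    obtain ⟨hr, hB⟩ := ((mem_region_III hg hbc (Or.inr rfl)).2 ⟨rfl, hb⟩).isSteady (a := u 0)
      (a' := v 0) (c := u 1) (c' := v 1) (Or.inr rfl) h2 h21 h3 h31.ne' h32.ne' (hs 0) (hs 1) hδ
      (by rw [← S0]; simp [hm, NR]; ring)
      (by rw [← D0]; simp [hm, NR]; ring)
      (by rw [← S1]; simp [hm, NR]; ring)
      (by rw [← D1]; simp [hm, NR]; ring)
    refine ⟨hr, ?_, ?_, ?_⟩ <;> rw [u2, v2]
    · exact trivial₂ _ _ _ _ _
    · exact trivial₂ _ _ _ _ _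
    · exact hB

/-- Equilibria of the generic equations, with no assumption on the momenta. -/
theorem isEquilibrium_iff {g : ℝ} (hg : 0 < g) {p : Phase} (hp : p.1 ∈ configSpace) :
    IsEquilibrium g p ↔ p.2.1 = 0 ∧ ∃ α, p.1 ∈ region g α ∧ ∃ δ : ℝ, (δ = 1 ∨ δ = -1) ∧
      ∃ s : V3, (∀ k, s k = 1 ∨ s k = -1) ∧
        p.2.2 = (s * μ g α δ p.1, s * μ g α (-δ) p.1) := by
  rw [isEquilibrium_iff_isSteady g hp]
  refine and_congr_right fun _ => ⟨exists_type_of_isSteady hg hp, ?_⟩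
  rintro ⟨α, hα, δ, hδ, s, hs, hm⟩
  exact isSteady_of_mem_region hg hα hδ hs hm

end RiemannEllipsoid

theorem proposition4 (g : ℝ) (hg : 0 < g) :
    -- the momenta are real-valued maps on the existence regions
    (∀ α : EllipsoidType, ∀ b ∈ region g α, MomentaAreReal g α b) ∧
    -- equilibria of the generic reduced systems
    (∀ η : V3 × V3, η.1 ≠ 0 → η.2 ≠ 0 → ∀ p ∈ reducedSpace η,
      (IsEquilibrium g p ↔
        ∃ α : EllipsoidType, ∃ b ∈ region g α,
          Equivalent p (b, 0, (μ g α 1 b, μ g α (-1) b)) ∨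
          Equivalent p (b, 0, (μ g α (-1) b, μ g α 1 b)))) ∧
    -- equilibria of the six-dimensional reduced systems
    (∀ η : V3 × V3, (η.1 ≠ 0 ∧ η.2 = 0) ∨ (η.1 = 0 ∧ η.2 ≠ 0) → ∀ p ∈ irrReducedSpace η,
      (IsIrrEquilibrium g p ↔
        ∃ α : EllipsoidType, ∃ b ∈ region g α,
          OnIrrotationalCurve g α b ∧ IrrEquivalent p (b, 0, μ g α 1 b))) ∧
    -- a momentum vanishes only on the two irrotational curves, and there only one of them does
    (∀ α : EllipsoidType, ∀ b ∈ region g α,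
      ((μ g α 1 b = 0 ∨ μ g α (-1) b = 0) ↔ OnIrrotationalCurve g α b) ∧
      (OnIrrotationalCurve g α b → μ g α 1 b ≠ 0 ∧ μ g α (-1) b = 0)) := by
  refine ⟨fun α b hb => momentaAreReal hg hb, ?_, ?_, ?_⟩
  · rintro η - - ⟨b, c, m⟩ hp
    rw [isEquilibrium_iff hg hp.1]
    simp only [equivalent_iff, Prod.mk.injEq]
    constructor
    · rintro ⟨rfl, α, hα, δ, rfl | rfl, s, hs, hm⟩
      · exact ⟨α, b, hα, Or.inl ⟨s, hs, rfl, rfl, hm⟩⟩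
      · rw [neg_neg] at hm
        exact ⟨α, b, hα, Or.inr ⟨s, hs, rfl, rfl, hm⟩⟩
    · rintro ⟨α, b, hα, ⟨s, hs, rfl, rfl, hm⟩ | ⟨s, hs, rfl, rfl, hm⟩⟩
      · exact ⟨rfl, α, hα, 1, Or.inl rfl, s, hs, hm⟩
      · exact ⟨rfl, α, hα, -1, Or.inr rfl, s, hs, by rw [neg_neg]; exact hm⟩
  · rintro η - ⟨b, c, m⟩ hp
    rw [isIrrEquilibrium_iff g hp.1, isEquilibrium_iff hg hp.1]
    simp only [irrEquivalent_iff, Prod.mk.injEq]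
    have cancel : ∀ {s w : V3}, (∀ k, s k = 1 ∨ s k = -1) → 0 = s * w → w = 0 := by
      intro s w hs h
      ext k
      have hk : s k ≠ 0 := by rcases hs k with h | h <;> rw [h] <;> norm_num
      have := congrFun h k
      simpa [hk, eq_comm] using this
    constructor
    · rintro ⟨rfl, α, hα, δ, rfl | rfl, s, hs, hm, h0⟩
      · exact ⟨α, b, hα, (momenta_eq_zero hg hα).2.1 (cancel hs h0), s, hs, rfl, rfl, hm⟩
      · rw [neg_neg] at h0
        exact ((momenta_eq_zero hg hα).1 (cancel hs h0)).elim
    · rintro ⟨α, b, hα, hcurve, s, hs, rfl, rfl, hm⟩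
      refine ⟨rfl, α, hα, 1, Or.inl rfl, s, hs, hm, ?_⟩
      rw [(momenta_eq_zero hg hα).2.2 hcurve, mul_zero]
  · intro α b hb
    obtain ⟨h1, h2⟩ := momenta_eq_zero hg hb
    exact ⟨⟨fun h => h2.1 (h.resolve_left h1), fun h => Or.inr (h2.2 h)⟩,
      fun h => ⟨h1, h2.2 h⟩⟩
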